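/- Let $\gamma$ be Euler's constant and let $\mathrm{Ein}(z)=\int_0^z\frac{1-e^{-t}}{t}\,dt$ for $z\in\mathbb{C}$. For integers $r,\kappa,n,m\ge 0$ let the constants $C_{r,\kappa}$ and $E_{n,m}$ be the Taylor coefficients at $0$ determined by $$\sum_{r=0}^{\infty}C_{r,\kappa}\,z^{r}=\frac{e^{\gamma z}}{\Gamma(\kappa+1-z)},\qquad \sum_{n=0}^{\infty}E_{n,m}\,z^{n}=\mathrm{Ein}(z)^m ,$$ both series converging for all $z\in\mathbb{C}$ (where $1/\Gamma$ is read as an entire function). For integers $\kappa\ge 0$, $\ell\ge 1$ and real $u\ge\ell$ let $$K_\ell(u,\kappa)=\frac{1}{\ell!}\int_{\substack{t_1,\dots,t_\ell\ge 1\\ t_1+\cdots+t_\ell\le u}}\bigl(u-(t_1+\cdots+t_\ell)\bigr)^{\kappa}\,\frac{dt_1}{t_1}\cdots\frac{dt_\ell}{t_\ell}.$$ Then for all integers $\kappa\ge 0$ and $\ell\ge 1$ and all real $u\ge\ell$, $$K_\ell(u,\kappa)=\sum_{m=0}^{\min(\kappa,\ell)}\ \sum_{n=m}^{\kappa}\ \sum_{r=0}^{\ell-m}D_{m,n,r,\kappa,\ell}\;u^{\kappa-n}\log^{\ell-m-r}u+O_{\kappa,\ell}\!\left(\frac{\log^{\ell}(eu)}{u}\right),$$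 where the implied constant depends only on $\kappa$ and $\ell$, and $$D_{m,n,r,\kappa,\ell}=\frac{(-1)^r\,\Gamma(\kappa+1)\,E_{n,m}}{m!\,(\ell-m-r)!}\,C_{r,\kappa-n}.$$ -/

import Mathlib

open scoped Nat
open MeasureTheory

namespace DickmanRelatives

/-- The multiple integral
`K_ℓ(u, κ) = (1/ℓ!) ∫_{t₁,…,t_ℓ ≥ 1, t₁+⋯+t_ℓ ≤ u} (u - (t₁+⋯+t_ℓ))^κ (dt₁/t₁)⋯(dt_ℓ/t_ℓ)`. -/
noncomputable def K (l : ℕ) (u : ℝ) (k : ℕ) : ℝ :=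
  (1 / (l ! : ℝ)) *
    ∫ t in {t : Fin l → ℝ | (∀ i, 1 ≤ t i) ∧ ∑ i, t i ≤ u},
      (u - ∑ i, t i) ^ k * ∏ i, (1 / t i)

/-- The entire function `Ein(z) = ∫_0^z (1 - e^{-w})/w dw`, integrated along the segment
`w = x z`, `0 ≤ x ≤ 1`. -/
noncomputable def Ein (z : ℂ) : ℂ :=
  ∫ x in (0 : ℝ)..1, (1 - Complex.exp (-((x : ℂ) * z))) / ((x : ℂ) * z) * z

/-- The function `e^{γ z} / Γ(κ + 1 - z)`. At the poles of `Γ` the value is `0`, as it should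
be for the entire function `1/Γ`, since `Complex.Gamma` takes the value `0` there. -/
noncomputable def genC (k : ℕ) (z : ℂ) : ℂ :=
  Complex.exp ((Real.eulerMascheroniConstant : ℂ) * z) / Complex.Gamma ((k : ℂ) + 1 - z)

/-- `C_{r,κ}`: the `r`-th Taylor coefficient at `0` of `e^{γ z} / Γ(κ + 1 - z)`. -/
noncomputable def C (r k : ℕ) : ℂ :=
  iteratedDeriv r (genC k) 0 / (r ! : ℂ)

/-- `E_{n,m}`: the `n`-th Taylor coefficient at `0` of `Ein(z)^m`. -/
noncomputable def E (n m : ℕ) : ℂ :=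
  iteratedDeriv n (fun z : ℂ => Ein z ^ m) 0 / (n ! : ℂ)

/-- `D_{m,n,r,κ,ℓ} = (-1)^r Γ(κ+1) E_{n,m} C_{r,κ-n} / (m! (ℓ-m-r)!)`, used only for
`n ≤ κ` and `m + r ≤ ℓ`. -/
noncomputable def D (m n r k l : ℕ) : ℂ :=
  (-1) ^ r * Complex.Gamma ((k : ℂ) + 1) * E n m / ((m ! : ℂ) * ((l - m - r)! : ℂ)) * C r (k - n)

end DickmanRelatives

/-! Splitting off one variable gives `(l+1) K_{l+1} = T K_l` with `(T f)(u) = ∫_0^{u-1} f(v)/(u-v)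
dv` (`K_succ`), so the theorem follows by induction on `l` once `T` is understood on a suitable
family of functions, up to small errors.

The family comes from `F_k(u,z) = e^{-γz} u^{k+z}/Γ(k+1+z)`; `powLog j k` is its coefficient of
`z^j`. Three contributions make up `T F_k`. The factor `1/(u-v)` integrated up to `u-1` gives `log u
· F_k`. The regularised integral over the whole of `[0,u]` gives `F_k · ∫_0^1 (x^{k+z}-1)/(1-x) dx =
F_k · (-γ - Γ'/Γ(k+1+z))`. Together these two are exactly `∂F_k/∂z` (`log_mul_powLog_add_integral`),
which is why the factor `e^{γz}` occurs in the constants.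

What remains is `-∫_0^1 (F_k(u-t) - F_k(u))/t dt`. Since `∂/∂u` sends `F_{k+1}` to `F_k`, Taylor
expansion in `t` turns this into `Ein(∂/∂u) F_k`; stopping at order `k` costs a multiple of
`log^j(eu)/u` for each coefficient (`norm_integral_near_le`). Hence `T` acts as `∂/∂z + Ein(∂/∂u)`
up to this error (`integral_powLog_div`).

The two operators commute, and `K_0 = u^k` is `k!` times the coefficient of `z^0` in `F_k`. The
binomial theorem for `T^l/l!` therefore produces the terms `Ein(∂/∂u)^m/m!`, whose coefficients are
`E_{n,m}/m!`, applied to the coefficient of `z^{l-m}` (`sum_mainRow_succ`). Finally, `T` preserves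
the error bound at the price of one more logarithm per step (`norm_errTerm_le`). -/

namespace DickmanRelatives

open PowerSeries Filter Topology

/-! ### Taylor series at `0` as formal power series. -/

/-- The Taylor series of `f` at `0`, as a formal power series. -/
noncomputable def taylorSeries (f : ℂ → ℂ) : PowerSeries ℂ :=
  PowerSeries.mk fun n => iteratedDeriv n f 0 / (n ! : ℂ)

lemma coeff_taylorSeries (f : ℂ → ℂ) (n : ℕ) :
    coeff n (taylorSeries f) = iteratedDeriv n f 0 / (n ! : ℂ) := by
  simp [taylorSeries]

lemma taylorSeries_mul {f g : ℂ → ℂ} (hf : AnalyticAt ℂ f 0) (hg : AnalyticAt ℂ g 0) :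
    taylorSeries (fun z => f z * g z) = taylorSeries f * taylorSeries g := by
  ext n
  rw [coeff_mul, coeff_taylorSeries, iteratedDeriv_fun_mul hf.contDiffAt hg.contDiffAt,
    Finset.Nat.sum_antidiagonal_eq_sum_range_succ_mk, Finset.sum_div]
  refine Finset.sum_congr rfl fun i hi => ?_
  have hi' : i ≤ n := Nat.lt_succ_iff.mp (Finset.mem_range.mp hi)
  rw [coeff_taylorSeries, coeff_taylorSeries, Nat.cast_choose ℂ hi']
  have h1 : (n ! : ℂ) ≠ 0 := Nat.cast_ne_zero.mpr n.factorial_ne_zero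
  have h2 : (i ! : ℂ) ≠ 0 := Nat.cast_ne_zero.mpr i.factorial_ne_zero
  have h3 : ((n - i)! : ℂ) ≠ 0 := Nat.cast_ne_zero.mpr (n - i).factorial_ne_zero
  field_simp

lemma taylorSeries_deriv (f : ℂ → ℂ) :
    taylorSeries (deriv f) = d⁄dX ℂ (taylorSeries f) := by
  ext n
  rw [coeff_derivative, coeff_taylorSeries, coeff_taylorSeries, iteratedDeriv_succ',
    Nat.factorial_succ]
  have h1 : (n ! : ℂ) ≠ 0 := Nat.cast_ne_zero.mpr n.factorial_ne_zero
  have h2 : ((n : ℂ) + 1) ≠ 0 := Nat.cast_add_one_ne_zero n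
  push_cast
  field_simp

lemma taylorSeries_congr {f g : ℂ → ℂ} (h : f =ᶠ[𝓝 0] g) : taylorSeries f = taylorSeries g := by
  ext n
  rw [coeff_taylorSeries, coeff_taylorSeries, h.iteratedDeriv_eq]

lemma hasFPowerSeriesAt_of_hasSum {f : ℂ → ℂ} {a : ℕ → ℂ}
    (h : ∀ᶠ z in 𝓝 0, HasSum (fun n => a n * z ^ n) (f z)) :
    HasFPowerSeriesAt f (FormalMultilinearSeries.ofScalars ℂ a) 0 := by
  rw [hasFPowerSeriesAt_iff]
  filter_upwards [h] with z hz
  simpa [FormalMultilinearSeries.coeff_ofScalars, mul_comm] using hz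

lemma taylorSeries_of_hasSum {f : ℂ → ℂ} {a : ℕ → ℂ}
    (h : ∀ᶠ z in 𝓝 0, HasSum (fun n => a n * z ^ n) (f z)) :
    taylorSeries f = PowerSeries.mk a := by
  have h1 := hasFPowerSeriesAt_of_hasSum h
  have h2 := h1.analyticAt.hasFPowerSeriesAt
  have h3 := h2.eq_formalMultilinearSeries h1
  ext n
  have := congrArg (fun p : FormalMultilinearSeries ℂ ℂ ℂ => p.coeff n) h3
  simpa [FormalMultilinearSeries.coeff_ofScalars, coeff_taylorSeries] using this

lemma hasSum_coeff_taylorSeries {f : ℂ → ℂ} (hf : Differentiable ℂ f) (z : ℂ) :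
    HasSum (fun n => iteratedDeriv n f 0 / (n ! : ℂ) * z ^ n) (f z) := by
  convert! Complex.hasSum_taylorSeries_of_entire hf 0 z using 2 with n
  simp only [sub_zero, smul_eq_mul]
  ring

/-! ### The function `Ein` and the constants `E`. -/

/-- The Taylor coefficients of `Ein`. -/
noncomputable def einCoeff (n : ℕ) : ℂ :=
  if n = 0 then 0 else -((-1) ^ n / ((n : ℂ) * (n ! : ℂ)))

/-- Termwise integration of the exponential series, with the dominating series `∑ ‖z‖^n/n!`. -/
lemma hasSum_Ein (z : ℂ) : HasSum (fun n => einCoeff n * z ^ n) (Ein z) := by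
  have key : HasSum (fun n : ℕ => ∫ x in (0 : ℝ)..1,
      (if n = 0 then 0 else -((-z) ^ n / (n ! : ℂ)) * (x : ℂ) ^ (n - 1))) (Ein z) := by
    refine intervalIntegral.hasSum_integral_of_dominated_convergence
      (fun n _ => ‖z‖ ^ n / (n ! : ℝ)) ?_ ?_ ?_ ?_ ?_
    · intro n
      refine Continuous.aestronglyMeasurable ?_
      split_ifs <;> fun_prop
    · refine fun n => ae_of_all _ fun x hx => ?_
      rw [Set.uIoc_of_le zero_le_one] at hx
      split_ifs with hn
      · rw [norm_zero]; positivity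
      · rw [norm_mul, norm_neg, norm_div, norm_pow, norm_neg, norm_pow, Complex.norm_natCast,
          Complex.norm_real, Real.norm_of_nonneg hx.1.le]
        exact mul_le_of_le_one_right (by positivity) (pow_le_one₀ hx.1.le hx.2)
    · exact ae_of_all _ fun x _ => Real.summable_pow_div_factorial ‖z‖
    · exact intervalIntegrable_const
    · refine ae_of_all _ fun x hx => ?_
      rw [Set.uIoc_of_le zero_le_one] at hx
      have hx0 : (x : ℂ) ≠ 0 := Complex.ofReal_ne_zero.mpr hx.1.ne'
      -- At `z = 0` the integrand is `0` through the final factor `z`, whatever value the division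
      -- by zero takes.
      rcases eq_or_ne z 0 with rfl | hz
      · convert! hasSum_zero using 2 with n
        · split_ifs with hn <;> simp [hn]
        · simp
      have h1 : HasSum (fun n : ℕ => (-((x : ℂ) * z)) ^ n / (n ! : ℂ))
          (Complex.exp (-((x : ℂ) * z))) := by
        rw [Complex.exp_eq_exp_ℂ]
        exact NormedSpace.expSeries_div_hasSum_exp _
      have h2 := (hasSum_ite_eq 0 (1 : ℂ)).sub h1
      have h3 := (h2.div_const ((x : ℂ) * z)).mul_right z
      refine h3.congr_fun fun n => ?_
      rcases n with _ | n
      · simp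
      · simp only [Nat.succ_ne_zero, if_false, Nat.add_sub_cancel]
        field_simp
        ring
  refine key.congr_fun fun n => ?_
  rcases eq_or_ne n 0 with rfl | hn
  · simp [einCoeff]
  · simp only [einCoeff, hn, if_false]
    rw [intervalIntegral.integral_const_mul]
    have : ∫ x in (0 : ℝ)..1, (x : ℂ) ^ (n - 1) = 1 / n := by
      have h := integral_pow (a := 0) (b := 1) (n - 1)
      have h' := congrArg (fun r : ℝ => (r : ℂ)) h
      simp only [← intervalIntegral.integral_ofReal] at h'
      push_cast at h'
      rw [h', Nat.sub_add_cancel (Nat.one_le_iff_ne_zero.mpr hn)]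
      simp only [one_pow, zero_pow hn, Nat.cast_sub (Nat.one_le_iff_ne_zero.mpr hn)]
      push_cast
      ring
    rw [this, neg_pow z n]
    field_simp

lemma analyticAt_Ein : AnalyticAt ℂ Ein 0 :=
  (hasFPowerSeriesAt_of_hasSum (Eventually.of_forall hasSum_Ein)).analyticAt

lemma taylorSeries_Ein : taylorSeries Ein = PowerSeries.mk einCoeff :=
  taylorSeries_of_hasSum (Eventually.of_forall hasSum_Ein)

lemma differentiable_Ein : Differentiable ℂ Ein := by
  have h : HasFPowerSeriesOnBall Ein (FormalMultilinearSeries.ofScalars ℂ einCoeff) 0 ⊤ := by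
    refine ⟨?_, by simp, fun {y} _ => ?_⟩
    · rw [top_le_iff, FormalMultilinearSeries.radius_eq_top_iff_summable_norm]
      intro r
      have := (hasSum_Ein (r : ℂ)).summable.norm
      simpa [FormalMultilinearSeries.ofScalars_norm, norm_mul] using this
    · simpa [FormalMultilinearSeries.ofScalars_apply_eq, mul_comm] using hasSum_Ein y
  have := h.differentiableOn
  simpa [differentiableOn_univ] using this

lemma taylorSeries_Ein_pow (m : ℕ) :
    taylorSeries (fun z => Ein z ^ m) = PowerSeries.mk einCoeff ^ m := by
  induction m with
  | zero =>
    simp only [pow_zero]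
    refine (taylorSeries_of_hasSum (a := fun n => if n = 0 then 1 else 0)
      (Eventually.of_forall fun z => ?_)).trans ?_
    · refine (hasSum_ite_eq 0 (1 : ℂ)).congr_fun fun n => ?_
      split_ifs with h <;> simp [h]
    · ext n; simp [coeff_one]
  | succ m ih =>
    simp only [pow_succ]
    rw [taylorSeries_mul (f := fun z => Ein z ^ m) (analyticAt_Ein.pow m) analyticAt_Ein, ih,
      taylorSeries_Ein]

lemma E_eq_coeff (n m : ℕ) : E n m = coeff n (PowerSeries.mk einCoeff ^ m) := by
  rw [← taylorSeries_Ein_pow, coeff_taylorSeries, E]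

lemma hasSum_E (m : ℕ) (z : ℂ) : HasSum (fun n : ℕ => E n m * z ^ n) (Ein z ^ m) :=
  hasSum_coeff_taylorSeries (differentiable_Ein.pow m) z

lemma E_zero (n : ℕ) : E n 0 = if n = 0 then 1 else 0 := by
  rw [E_eq_coeff, pow_zero, coeff_one]

lemma E_succ (n m : ℕ) :
    E n (m + 1) = ∑ p ∈ Finset.HasAntidiagonal.antidiagonal n, E p.1 m * einCoeff p.2 := by
  simp only [E_eq_coeff, pow_succ, coeff_mul, coeff_mk]

/-- `Ein` vanishes at `0`, so its `m`-th power has order at least `m`. This allows sums over `n ≥ m`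
to be replaced by sums over all `n`. -/
lemma E_eq_zero {n m : ℕ} (h : n < m) : E n m = 0 := by
  rw [E_eq_coeff]
  refine coeff_of_lt_order _ (lt_of_lt_of_le (Nat.cast_lt.mpr h)
    (le_order_pow_of_constantCoeff_eq_zero m ?_))
  simp [← coeff_zero_eq_constantCoeff_apply, einCoeff]

/-! ### The integral `∫_0^1 (x^{k+z}-1)/(1-x) dx` and the logarithmic derivative of `Γ`. -/

/-- The integrand of the coefficients of `∫₀¹ (x^(k+z) - 1)/(1-x) dx`. -/
noncomputable def psiKernel (k a : ℕ) (x : ℝ) : ℝ :=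
  (x ^ k * Real.log x ^ a - if a = 0 then 1 else 0) / (1 - x)

/-- The derivatives at `z = 0` of `∫₀¹ (x^(k+z) - 1)/(1-x) dx`. -/
noncomputable def psiCoeff (k a : ℕ) : ℝ := ∫ x in (0 : ℝ)..1, psiKernel k a x

/-- This is `log y ≤ y - 1` at `y = x^{-1/2}`. The factor `1 - x` cancels the pole of the kernel at
`1`, at the price of an integrable singularity at `0`. -/
lemma neg_log_le {x : ℝ} (h0 : 0 < x) (h1 : x < 1) :
    -Real.log x ≤ 2 * (1 - x) * x ^ (-(1 / 2) : ℝ) := by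
  have h := Real.log_le_sub_one_of_pos (Real.rpow_pos_of_pos h0 (-(1 / 2)))
  rw [Real.log_rpow h0] at h
  have h2 : x * x ^ (-(1 / 2) : ℝ) ≤ 1 := by
    have : x * x ^ (-(1 / 2) : ℝ) = x ^ (1 / 2 : ℝ) := by
      nth_rewrite 1 [← Real.rpow_one x]
      rw [← Real.rpow_add h0]; norm_num
    rw [this]
    exact Real.rpow_le_one h0.le h1.le (by norm_num)
  nlinarith

/-- For `a = 0` the kernel is minus a finite geometric sum. Otherwise one logarithm is spent on the
pole at `1` and costs `x^{-1/2}`; the others cost `x^{-1/4}` through `y^a/a! ≤ e^y` with `y = -log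
x/4`. The resulting `4^a` is the reason for the later restriction `‖z‖ < 1/4`. -/
lemma abs_psiKernel_le (k a : ℕ) {x : ℝ} (h0 : 0 < x) (h1 : x < 1) :
    |psiKernel k a x| ≤ (k + 2) * (a ! * 4 ^ a) * x ^ (-(3 / 4) : ℝ) := by
  have hx : 0 < 1 - x := by linarith
  have hone : (1 : ℝ) ≤ x ^ (-(3 / 4) : ℝ) :=
    Real.one_le_rpow_of_pos_of_le_one_of_nonpos h0 h1.le (by norm_num)
  rcases a with _ | a
  · have hgeom : (∑ i ∈ Finset.range k, x ^ i) * (1 - x) = 1 - x ^ k := geom_sum_mul_neg x k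
    have hle : ∑ i ∈ Finset.range k, x ^ i ≤ k := by
      calc ∑ i ∈ Finset.range k, x ^ i ≤ ∑ i ∈ Finset.range k, 1 :=
            Finset.sum_le_sum fun i _ => pow_le_one₀ h0.le h1.le
        _ = k := by simp
    have hnn : 0 ≤ ∑ i ∈ Finset.range k, x ^ i := Finset.sum_nonneg fun i _ => by positivity
    have : psiKernel k 0 x = -∑ i ∈ Finset.range k, x ^ i := by
      rw [psiKernel, div_eq_iff hx.ne']
      simp only [pow_zero, mul_one, if_true]
      linarith
    rw [this, abs_neg, abs_of_nonneg hnn]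
    simp only [Nat.factorial_zero, Nat.cast_one, pow_zero, mul_one]
    nlinarith [Nat.cast_nonneg (α := ℝ) k]
  · have hL : 0 < -Real.log x := neg_pos.mpr (Real.log_neg h0 h1)
    have habs : |psiKernel k (a + 1) x| = x ^ k * (-Real.log x) ^ a * (-Real.log x) / (1 - x) := by
      rw [psiKernel, if_neg (Nat.succ_ne_zero a), sub_zero, abs_div, abs_of_pos hx, abs_mul,
        abs_of_pos (pow_pos h0 k), abs_pow, ← abs_neg (Real.log x), abs_of_pos hL, pow_succ,
        mul_assoc]
    have hpow : (-Real.log x) ^ a ≤ a ! * 4 ^ a * x ^ (-(1 / 4) : ℝ) := by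
      have h := Real.pow_div_factorial_le_exp (-Real.log x / 4) (by positivity) a
      rw [div_le_iff₀ (by positivity), div_pow, div_le_iff₀ (by positivity)] at h
      rw [Real.rpow_def_of_pos h0]
      refine h.trans (le_of_eq ?_)
      rw [show Real.log x * (-(1 / 4)) = -Real.log x / 4 by ring]
      ring
    rw [habs, div_le_iff₀ hx]
    have hlog := neg_log_le h0 h1
    have hsplit : x ^ (-(3 / 4) : ℝ) = x ^ (-(1 / 4) : ℝ) * x ^ (-(1 / 2) : ℝ) := by
      rw [← Real.rpow_add h0]; norm_num
    calc x ^ k * (-Real.log x) ^ a * (-Real.log x)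
        ≤ 1 * (a ! * 4 ^ a * x ^ (-(1 / 4) : ℝ)) * (2 * (1 - x) * x ^ (-(1 / 2) : ℝ)) := by
          gcongr
          exact pow_le_one₀ h0.le h1.le
      _ = 2 * (a ! * 4 ^ a) * x ^ (-(3 / 4) : ℝ) * (1 - x) := by rw [hsplit]; ring
      _ ≤ (k + 2) * ((a + 1)! * 4 ^ (a + 1)) * x ^ (-(3 / 4) : ℝ) * (1 - x) := by
          have e1 : (a ! : ℝ) ≤ ((a + 1)! : ℝ) := by exact_mod_cast Nat.factorial_le (Nat.le_succ a)
          have e2 : (4 : ℝ) ^ a ≤ 4 ^ (a + 1) := pow_le_pow_right₀ (by norm_num) (Nat.le_succ a)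
          have e3 : (2 : ℝ) ≤ k + 2 := by linarith [Nat.cast_nonneg (α := ℝ) k]
          gcongr

lemma intervalIntegrable_bound : IntervalIntegrable (fun x : ℝ => x ^ (-(3 / 4) : ℝ)) volume 0 1 :=
  intervalIntegral.intervalIntegrable_rpow' (by norm_num)

lemma measurable_psiKernel (k a : ℕ) : Measurable (psiKernel k a) := by
  unfold psiKernel; fun_prop

/-- Outside a null set, a point of `(0, 1]` lies in `(0, 1)`. -/
lemma ae_uIoc_zero_one {P : ℝ → Prop} (h : ∀ x, 0 < x → x < 1 → P x) :
    ∀ᵐ x : ℝ, x ∈ Set.uIoc (0 : ℝ) 1 → P x := by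
  filter_upwards [compl_mem_ae_iff.mpr (measure_singleton (1 : ℝ))] with x hx hx'
  rw [Set.uIoc_of_le zero_le_one] at hx'
  exact h x hx'.1 (lt_of_le_of_ne hx'.2 hx)

lemma intervalIntegrable_psiKernel (k a : ℕ) :
    IntervalIntegrable (psiKernel k a) volume 0 1 := by
  refine (intervalIntegrable_bound.const_mul ((k + 2) * (a ! * 4 ^ a) : ℝ)).mono_fun'
    (measurable_psiKernel k a).aestronglyMeasurable ?_
  rw [EventuallyLE, ae_restrict_iff' measurableSet_uIoc]
  exact ae_uIoc_zero_one fun x h0 h1 => abs_psiKernel_le k a h0 h1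

/-- The function `∫₀¹ (x^(k+z) - 1)/(1-x) dx`. -/
noncomputable def psiFun (k : ℕ) (z : ℂ) : ℂ :=
  ∫ x in (0 : ℝ)..1, ((x : ℂ) ^ k * Complex.exp (z * Real.log x) - 1) / (1 - x)

lemma hasSum_psiKernel (k : ℕ) (z : ℂ) (x : ℝ) :
    HasSum (fun a : ℕ => (psiKernel k a x : ℂ) / (a ! : ℂ) * z ^ a)
      (((x : ℂ) ^ k * Complex.exp (z * Real.log x) - 1) / (1 - x)) := by
  have h1 : HasSum (fun n : ℕ => (z * Real.log x) ^ n / (n ! : ℂ))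
      (Complex.exp (z * Real.log x)) := by
    rw [Complex.exp_eq_exp_ℂ]
    exact NormedSpace.expSeries_div_hasSum_exp _
  have h2 := ((h1.mul_left ((x : ℂ) ^ k)).sub (hasSum_ite_eq 0 (1 : ℂ))).div_const (1 - (x : ℂ))
  refine h2.congr_fun fun a => ?_
  rw [psiKernel]
  push_cast
  rcases eq_or_ne a 0 with rfl | ha
  · simp
  · simp only [ha, if_false, mul_pow, Complex.ofReal_zero]
    ring

lemma norm_psiTerm_le (k a : ℕ) (z : ℂ) {x : ℝ} (h0 : 0 < x) (h1 : x < 1) :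
    ‖(psiKernel k a x : ℂ) / (a ! : ℂ) * z ^ a‖ ≤
      (k + 2) * (4 * ‖z‖) ^ a * x ^ (-(3 / 4) : ℝ) := by
  rw [norm_mul, norm_div, norm_pow, Complex.norm_real, Complex.norm_natCast, Real.norm_eq_abs]
  have ha : (0 : ℝ) < a ! := by positivity
  calc |psiKernel k a x| / a ! * ‖z‖ ^ a
      ≤ (k + 2) * (a ! * 4 ^ a) * x ^ (-(3 / 4) : ℝ) / a ! * ‖z‖ ^ a := by
        gcongr; exact abs_psiKernel_le k a h0 h1
    _ = (k + 2) * (4 * ‖z‖) ^ a * x ^ (-(3 / 4) : ℝ) := by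
        rw [mul_pow]; field_simp

lemma summable_psiBound (k : ℕ) {z : ℂ} (hz : ‖z‖ < 1 / 4) :
    Summable fun a : ℕ => ((k : ℝ) + 2) * (4 * ‖z‖) ^ a :=
  (summable_geometric_of_lt_one (by positivity) (by linarith)).mul_left _

lemma hasSum_psiFun (k : ℕ) {z : ℂ} (hz : ‖z‖ < 1 / 4) :
    HasSum (fun a : ℕ => (psiCoeff k a : ℂ) / (a ! : ℂ) * z ^ a) (psiFun k z) := by
  have hs := summable_psiBound k hz
  have key : HasSum (fun a : ℕ => ∫ x in (0 : ℝ)..1, (psiKernel k a x : ℂ) / (a ! : ℂ) * z ^ a)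
      (psiFun k z) := by
    refine intervalIntegral.hasSum_integral_of_dominated_convergence
      (fun a x => (k + 2) * (4 * ‖z‖) ^ a * x ^ (-(3 / 4) : ℝ)) ?_ ?_ ?_ ?_ ?_
    · intro a
      have := measurable_psiKernel k a
      exact Measurable.aestronglyMeasurable (by fun_prop)
    · exact fun a => ae_uIoc_zero_one fun x h0 h1 => norm_psiTerm_le k a z h0 h1
    · exact ae_of_all _ fun x _ => hs.mul_right _
    · simp_rw [tsum_mul_right]
      exact intervalIntegrable_bound.const_mul _
    · exact ae_of_all _ fun x _ => hasSum_psiKernel k z x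
  refine key.congr_fun fun a => ?_
  rw [intervalIntegral.integral_mul_const, intervalIntegral.integral_div,
    intervalIntegral.integral_ofReal, psiCoeff]

lemma norm_psiIntegrand_le (k : ℕ) {z : ℂ} (hz : ‖z‖ < 1 / 4) {x : ℝ} (h0 : 0 < x) (h1 : x < 1) :
    ‖((x : ℂ) ^ k * Complex.exp (z * Real.log x) - 1) / (1 - x)‖ ≤
      (∑' a : ℕ, ((k : ℝ) + 2) * (4 * ‖z‖) ^ a) * x ^ (-(3 / 4) : ℝ) := by
  have h := hasSum_psiKernel k z x
  rw [← h.tsum_eq, ← tsum_mul_right]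
  exact tsum_of_norm_bounded ((summable_psiBound k hz).mul_right _).hasSum
    fun a => norm_psiTerm_le k a z h0 h1

/-- Inserting `(1-x)^e` makes both parts of the integrand separately integrable: one gives the beta
integral, the other `∫_0^1 (1-x)^{e-1} dx = 1/e`. Dominated convergence then lets `e` tend to `0`.
-/
lemma psiFun_eq_limit (k : ℕ) {z : ℂ} (hz : ‖z‖ < 1 / 4) :
    Tendsto (fun e : ℝ => Complex.betaIntegral ((k : ℂ) + 1 + z) e - 1 / e) (𝓝[>] 0)
      (𝓝 (psiFun k z)) := by
  have hre : 0 < ((k : ℂ) + 1 + z).re := by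
    have := (abs_le.mp (Complex.abs_re_le_norm z)).1
    simp only [Complex.add_re, Complex.natCast_re, Complex.one_re]
    linarith [Nat.cast_nonneg (α := ℝ) k]
  have hrepr : ∀ᶠ e : ℝ in 𝓝[>] 0, (∫ x in (0 : ℝ)..1,
      ((1 - x : ℝ) ^ e : ℝ) * (((x : ℂ) ^ k * Complex.exp (z * Real.log x) - 1) / (1 - x))) =
      Complex.betaIntegral ((k : ℂ) + 1 + z) e - 1 / e := by
    filter_upwards [self_mem_nhdsWithin] with e he
    have he' : 0 < (e : ℂ).re := he
    rw [← Complex.betaIntegral_eval_one_right he', Complex.betaIntegral_symm 1 (e : ℂ)]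
    unfold Complex.betaIntegral
    rw [← intervalIntegral.integral_sub (Complex.betaIntegral_convergent hre he')
      (Complex.betaIntegral_convergent (by simp) he')]
    refine intervalIntegral.integral_congr_ae (ae_uIoc_zero_one fun x h0 h1 => ?_)
    have hx : (0 : ℝ) < 1 - x := by linarith
    have hx' : (1 - (x : ℂ)) ≠ 0 := by exact_mod_cast hx.ne'
    have hx0 : (x : ℂ) ≠ 0 := by exact_mod_cast h0.ne'
    have e1 : (x : ℂ) ^ ((k : ℂ) + 1 + z - 1) = (x : ℂ) ^ k * Complex.exp (z * Real.log x) := by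
      rw [show (k : ℂ) + 1 + z - 1 = k + z by ring, Complex.cpow_add _ _ hx0, Complex.cpow_natCast,
        Complex.cpow_def_of_ne_zero hx0 z, ← Complex.ofReal_log h0.le, mul_comm z]
    have e2 : (1 - (x : ℂ)) ^ ((e : ℂ) - 1) = ((1 - x : ℝ) ^ e : ℝ) / (1 - x) := by
      rw [Complex.cpow_sub _ _ hx', Complex.cpow_one, Complex.ofReal_cpow hx.le]
      push_cast; rfl
    rw [e1, e2, sub_self, Complex.cpow_zero]
    ring
  refine Tendsto.congr' hrepr ?_
  refine intervalIntegral.tendsto_integral_filter_of_dominated_convergence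
    (fun x => (∑' a : ℕ, ((k : ℝ) + 2) * (4 * ‖z‖) ^ a) * x ^ (-(3 / 4) : ℝ)) ?_ ?_ ?_ ?_
  · exact Eventually.of_forall fun e => Measurable.aestronglyMeasurable (by fun_prop)
  · filter_upwards [self_mem_nhdsWithin] with e he
    refine ae_uIoc_zero_one fun x h0 h1 => ?_
    rw [norm_mul, Complex.norm_real, Real.norm_of_nonneg (Real.rpow_nonneg (by linarith) _)]
    refine (mul_le_of_le_one_left (norm_nonneg _) ?_).trans (norm_psiIntegrand_le k hz h0 h1)
    exact Real.rpow_le_one (by linarith) (by linarith) (le_of_lt he)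
  · exact intervalIntegrable_bound.const_mul _
  · refine ae_uIoc_zero_one fun x h0 h1 => ?_
    have hx : (0 : ℝ) < 1 - x := by linarith
    have h : Tendsto (fun e : ℝ => (1 - x) ^ e) (𝓝[>] 0) (𝓝 1) := by
      have := (Real.continuous_const_rpow hx.ne').tendsto 0
      rw [Real.rpow_zero] at this
      exact this.mono_left nhdsWithin_le_nhds
    have h2 := ((Complex.continuous_ofReal.tendsto 1).comp h).mul_const
      (((x : ℂ) ^ k * Complex.exp (z * Real.log x) - 1) / (1 - x))
    simpa using h2

/-- With `p = k+1+z`, the beta-gamma relation gives `B(p,e) - 1/e = (Γ(p)Γ(1+e)/Γ(p+e) - 1)/e`. This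
is a difference quotient at `0`, whose limit is computed from `Γ'(1) = -γ`. -/
lemma psiFun_eq (k : ℕ) {z : ℂ} (hz : ‖z‖ < 1 / 4) :
    psiFun k z = -(Real.eulerMascheroniConstant : ℂ) -
      deriv Complex.Gamma ((k : ℂ) + 1 + z) / Complex.Gamma ((k : ℂ) + 1 + z) := by
  set p : ℂ := (k : ℂ) + 1 + z with hp
  have hre : 0 < p.re := by
    have := (abs_le.mp (Complex.abs_re_le_norm z)).1
    simp only [hp, Complex.add_re, Complex.natCast_re, Complex.one_re]
    linarith [Nat.cast_nonneg (α := ℝ) k]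
  have hG : ∀ s : ℂ, 0 < s.re → Complex.Gamma s ≠ 0 := fun s => Complex.Gamma_ne_zero_of_re_pos
  have hd : ∀ s : ℂ, 0 < s.re → DifferentiableAt ℂ Complex.Gamma s := fun s hs =>
    Complex.differentiableAt_Gamma _ fun m h => by
      have := congrArg Complex.re h
      simp only [Complex.neg_re, Complex.natCast_re] at this
      linarith [Nat.cast_nonneg (α := ℝ) m]
  have h1 : HasDerivAt (fun s : ℂ => Complex.Gamma (1 + s))
      (-(Real.eulerMascheroniConstant : ℂ)) 0 := by
    refine HasDerivAt.comp_const_add (1 : ℂ) 0 ?_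
    rw [add_zero]; exact Complex.hasDerivAt_Gamma_one
  have h2 : HasDerivAt (fun s : ℂ => Complex.Gamma (p + s)) (deriv Complex.Gamma p) 0 := by
    refine HasDerivAt.comp_const_add p 0 ?_
    rw [add_zero]; exact (hd p hre).hasDerivAt
  have h3 := (h1.const_mul (Complex.Gamma p)).div h2 (by rw [add_zero]; exact hG p hre)
  have h4 := h3.comp_ofReal (z := 0)
  have h5 := h4.hasDerivWithinAt (s := Set.Ioi 0)
  rw [hasDerivWithinAt_iff_tendsto_slope' (by simp)] at h5
  refine (tendsto_nhds_unique (psiFun_eq_limit k hz) (h5.congr' ?_)).trans ?_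
  · filter_upwards [self_mem_nhdsWithin] with e he
    have he0 : (e : ℂ) ≠ 0 := by exact_mod_cast (ne_of_gt he)
    have hbeta := Complex.Gamma_mul_Gamma_eq_betaIntegral hre (t := (e : ℂ)) he
    have hpe : Complex.Gamma (p + e) ≠ 0 := hG _ (by simpa using add_pos hre he)
    rw [slope_def_module]
    simp only [Pi.div_apply, Complex.ofReal_zero, add_zero, Complex.Gamma_one, sub_zero, mul_one]
    rw [div_self (hG p hre), add_comm 1 (e : ℂ), Complex.Gamma_add_one _ he0,
      show Complex.Gamma p * (e * Complex.Gamma e) = e * (Complex.Gamma p * Complex.Gamma e) by ring,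
      hbeta, Complex.real_smul]
    push_cast
    rw [← hp]
    field_simp
  · simp only [add_zero, Complex.Gamma_one]
    have := hG p hre
    field_simp

/-! ### The constants `C` and the Taylor series of `e^{-γz}/Γ(k+1+z)`. -/

lemma differentiable_genC (k : ℕ) : Differentiable ℂ (genC k) := by
  have h : genC k = fun z => Complex.exp ((Real.eulerMascheroniConstant : ℂ) * z) *
      (Complex.Gamma ((k : ℂ) + 1 - z))⁻¹ := by
    ext z; rw [genC, div_eq_mul_inv]
  rw [h]
  refine Differentiable.mul (by fun_prop) ?_
  exact Complex.differentiable_one_div_Gamma.comp (by fun_prop)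

lemma hasSum_C (k : ℕ) (z : ℂ) : HasSum (fun r : ℕ => C r k * z ^ r) (genC k z) :=
  hasSum_coeff_taylorSeries (differentiable_genC k) z

/-- The Taylor series of `exp (-γ z) / Γ (k + 1 + z)`. -/
noncomputable def gammaSeries (k : ℕ) : PowerSeries ℂ := taylorSeries fun z => genC k (-z)

lemma coeff_gammaSeries (j k : ℕ) : coeff j (gammaSeries k) = (-1) ^ j * C j k := by
  rw [gammaSeries, coeff_taylorSeries, iteratedDeriv_comp_neg, C, neg_zero, smul_eq_mul,
    mul_div_assoc]

lemma coeff_zero_gammaSeries (k : ℕ) : coeff 0 (gammaSeries k) = 1 / (k ! : ℂ) := by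
  rw [gammaSeries, coeff_taylorSeries, iteratedDeriv_zero, genC]
  simp [Complex.Gamma_nat_eq_factorial]

lemma analyticAt_genC_neg (k : ℕ) : AnalyticAt ℂ (fun z => genC k (-z)) 0 :=
  ((differentiable_genC k).comp differentiable_neg).analyticAt 0

/-- The functional equation of `Γ`. At `k+1+z = 0` both sides vanish, because `Complex.Gamma 0 = 0`
and division by zero gives `0`. -/
lemma genC_neg_eq (k : ℕ) (z : ℂ) :
    genC k (-z) = ((k + 1 : ℂ) + z) * genC (k + 1) (-z) := by
  unfold genC
  push_cast
  rcases eq_or_ne ((k : ℂ) + 1 + z) 0 with h | h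
  · rw [sub_neg_eq_add, h, Complex.Gamma_zero]; simp
  · rw [show (k : ℂ) + 1 + 1 - -z = ((k : ℂ) + 1 + z) + 1 by ring, Complex.Gamma_add_one _ h,
      sub_neg_eq_add]
    field_simp

lemma taylorSeries_const_add (c : ℂ) :
    taylorSeries (fun z => c + z) = PowerSeries.C c + X := by
  rw [taylorSeries_of_hasSum (a := fun n => coeff n (PowerSeries.C c + X))]
  · ext n; simp
  · refine Eventually.of_forall fun z => ?_
    have h := hasSum_sum_of_ne_finset_zero (L := SummationFilter.unconditional ℕ)
      (s := Finset.range 2)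
      (f := fun n => coeff n (PowerSeries.C c + X : PowerSeries ℂ) * z ^ n) fun n hn => by
        simp only [Finset.mem_range, not_lt] at hn
        have h0 : n ≠ 0 := by omega
        have h1 : n ≠ 1 := by omega
        simp [coeff_C, coeff_X, h0, h1]
    simpa [Finset.sum_range_succ, coeff_X] using h

lemma gammaSeries_eq (k : ℕ) :
    gammaSeries k = (PowerSeries.C (k + 1 : ℂ) + X) * gammaSeries (k + 1) := by
  rw [← taylorSeries_const_add, gammaSeries, gammaSeries,
    ← taylorSeries_mul (by fun_prop) (analyticAt_genC_neg (k + 1))]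
  exact congrArg _ (funext fun z => genC_neg_eq k z)

/-- The Taylor series of `∫₀¹ (x^(k+z) - 1)/(1-x) dx`. -/
noncomputable def psiSeries (k : ℕ) : PowerSeries ℂ :=
  PowerSeries.mk fun a => (psiCoeff k a : ℂ) / (a ! : ℂ)

/-- The logarithmic derivative of `e^{-γz}/Γ(k+1+z)` is `-γ - Γ'/Γ(k+1+z)`, which is `psiFun k z`
near `0`. -/
lemma derivative_gammaSeries (k : ℕ) :
    d⁄dX ℂ (gammaSeries k) = gammaSeries k * psiSeries k := by
  have hball : ∀ᶠ z : ℂ in 𝓝 0, ‖z‖ < 1 / 4 := by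
    filter_upwards [Metric.ball_mem_nhds (0 : ℂ) (by norm_num : (0 : ℝ) < 1 / 4)] with z hz
    simpa using hz
  have hsum := hball.mono fun z hz => hasSum_psiFun k hz
  have h1 : taylorSeries (psiFun k) = psiSeries k := taylorSeries_of_hasSum hsum
  have h2 : AnalyticAt ℂ (psiFun k) 0 := (hasFPowerSeriesAt_of_hasSum hsum).analyticAt
  rw [gammaSeries, ← taylorSeries_deriv, ← h1, ← taylorSeries_mul (analyticAt_genC_neg k) h2]
  refine taylorSeries_congr (hball.mono fun z hz => ?_)
  have hre : 0 < ((k : ℂ) + 1 + z).re := by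
    have := (abs_le.mp (Complex.abs_re_le_norm z)).1
    simp only [Complex.add_re, Complex.natCast_re, Complex.one_re]
    linarith [Nat.cast_nonneg (α := ℝ) k]
  have hne := Complex.Gamma_ne_zero_of_re_pos hre
  have hd : DifferentiableAt ℂ Complex.Gamma ((k : ℂ) + 1 + z) :=
    Complex.differentiableAt_Gamma _ fun m h => by
      have := congrArg Complex.re h
      simp only [Complex.neg_re, Complex.natCast_re] at this hre
      linarith [Nat.cast_nonneg (α := ℝ) m]
  have hG := hd.hasDerivAt.comp_const_add ((k : ℂ) + 1) z
  have hE : HasDerivAt (fun w : ℂ => Complex.exp (-(Real.eulerMascheroniConstant : ℂ) * w))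
      (Complex.exp (-(Real.eulerMascheroniConstant : ℂ) * z) *
        (-(Real.eulerMascheroniConstant : ℂ) * 1)) z :=
    ((hasDerivAt_id z).const_mul _).cexp
  have hfun : (fun w => genC k (-w)) = fun w =>
      Complex.exp (-(Real.eulerMascheroniConstant : ℂ) * w) / Complex.Gamma ((k : ℂ) + 1 + w) := by
    ext w; rw [genC]; congr 2 <;> ring
  rw [hfun, (hE.fun_div hG hne).deriv]
  change _ = genC k (-z) * psiFun k z
  rw [congrFun hfun z, psiFun_eq k hz]
  field_simp

/-! ### The functions `powLog` and their exact identities. -/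

/-- The power series `exp (L z)`. -/
noncomputable def expSeries (L : ℝ) : PowerSeries ℂ :=
  PowerSeries.mk fun n => (L : ℂ) ^ n / (n ! : ℂ)

lemma expSeries_eq_rescale (L : ℝ) : expSeries L = rescale (L : ℂ) (exp ℂ) := by
  ext n
  simp [expSeries, coeff_rescale, coeff_exp, div_eq_mul_inv]

lemma expSeries_add (L M : ℝ) : expSeries (L + M) = expSeries L * expSeries M := by
  simp only [expSeries_eq_rescale, exp_mul_exp_eq_exp_add, Complex.ofReal_add]

lemma derivative_expSeries (L : ℝ) :
    d⁄dX ℂ (expSeries L) = PowerSeries.C (L : ℂ) * expSeries L := by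
  ext n
  rw [coeff_derivative, coeff_C_mul, expSeries, coeff_mk, coeff_mk, Nat.factorial_succ]
  have h1 : (n ! : ℂ) ≠ 0 := Nat.cast_ne_zero.mpr n.factorial_ne_zero
  have h2 : ((n : ℂ) + 1) ≠ 0 := Nat.cast_add_one_ne_zero n
  push_cast
  field_simp
  ring

lemma hasDerivAt_coeff_expSeries (n : ℕ) (L : ℝ) :
    HasDerivAt (fun L : ℝ => coeff n (expSeries L)) (coeff n (X * expSeries L)) L := by
  simp only [expSeries, coeff_mk]
  rcases n with _ | n
  · simpa using hasDerivAt_const L (1 : ℂ)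
  · rw [coeff_succ_X_mul, coeff_mk]
    have h := (((hasDerivAt_id (L : ℂ)).pow (n + 1)).div_const ((n + 1)! : ℂ)).comp_ofReal
    convert! h using 1
    have h1 : (n ! : ℂ) ≠ 0 := Nat.cast_ne_zero.mpr n.factorial_ne_zero
    have h2 : ((n : ℂ) + 1) ≠ 0 := Nat.cast_add_one_ne_zero n
    rw [Nat.factorial_succ]
    push_cast
    simp only [id, mul_one]
    field_simp

lemma hasDerivAt_coeff_mul_expSeries (p : PowerSeries ℂ) (n : ℕ) (L : ℝ) :
    HasDerivAt (fun L : ℝ => coeff n (p * expSeries L)) (coeff n (X * (p * expSeries L))) L := by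
  rw [mul_left_comm]
  simp only [coeff_mul]
  have h := HasDerivAt.fun_sum (u := Finset.HasAntidiagonal.antidiagonal n)
    (fun q _ => (hasDerivAt_coeff_expSeries q.2 L).const_mul (coeff q.1 p))
  simpa only [coeff_mul] using h

/-- The coefficient of `z^j` in `exp (-γ z) u^(k+z) / Γ (k + 1 + z)`. -/
noncomputable def powLog (j k : ℕ) (u : ℝ) : ℂ :=
  (u : ℂ) ^ k * coeff j (gammaSeries k * expSeries (Real.log u))

lemma powLog_eq_sum (j k : ℕ) (u : ℝ) :
    powLog j k u = ∑ r ∈ Finset.range (j + 1),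
      (-1) ^ r * C r k / ((j - r)! : ℂ) * (u : ℂ) ^ k * ((Real.log u : ℝ) : ℂ) ^ (j - r) := by
  rw [powLog, coeff_mul, Finset.Nat.sum_antidiagonal_eq_sum_range_succ_mk, Finset.mul_sum]
  refine Finset.sum_congr rfl fun r _ => ?_
  rw [coeff_gammaSeries, expSeries, coeff_mk]
  ring

/-- The derivative of `powLog j 0`. -/
noncomputable def powLogTail (j : ℕ) (u : ℝ) : ℂ :=
  (u : ℂ)⁻¹ * coeff j (X * (gammaSeries 0 * expSeries (Real.log u)))

lemma hasDerivAt_coeff_log (p : PowerSeries ℂ) (j : ℕ) {u : ℝ} (hu : 0 < u) :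
    HasDerivAt (fun u : ℝ => coeff j (p * expSeries (Real.log u)))
      ((u : ℂ)⁻¹ * coeff j (X * (p * expSeries (Real.log u)))) u := by
  have h := (hasDerivAt_coeff_mul_expSeries p j (Real.log u)).scomp u (Real.hasDerivAt_log hu.ne')
  simpa [Function.comp_def] using h

lemma hasDerivAt_powLog_zero (j : ℕ) {u : ℝ} (hu : 0 < u) :
    HasDerivAt (powLog j 0) (powLogTail j u) u := by
  have h := hasDerivAt_coeff_log (gammaSeries 0) j hu
  convert! h using 1
  ext v; simp [powLog]

/-- The coefficient form of `d/du (u^{k+1+z}/Γ(k+2+z)) = u^{k+z}/Γ(k+1+z)`: the factor `k+1+z` is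
absorbed by `Γ`. -/
lemma hasDerivAt_powLog_succ (j k : ℕ) {u : ℝ} (hu : 0 < u) :
    HasDerivAt (powLog j (k + 1)) (powLog j k u) u := by
  have h1 := ((hasDerivAt_id (u : ℂ)).pow (k + 1)).comp_ofReal
  have h := h1.mul (hasDerivAt_coeff_log (gammaSeries (k + 1)) j hu)
  have hu' : (u : ℂ) ≠ 0 := by exact_mod_cast hu.ne'
  convert! h using 1
  rw [powLog, gammaSeries_eq k, mul_assoc, add_mul, map_add, coeff_C_mul]
  simp only [id, Nat.add_sub_cancel, mul_one]
  push_cast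
  rw [Pi.pow_apply, id, pow_succ]
  field_simp

lemma continuousOn_powLog (j k : ℕ) : ContinuousOn (powLog j k) (Set.Ioi 0) := by
  intro u hu
  rcases k with _ | k
  · exact (hasDerivAt_powLog_zero j hu).continuousAt.continuousWithinAt
  · exact (hasDerivAt_powLog_succ j k hu).continuousAt.continuousWithinAt

lemma powLog_mul (j k : ℕ) {u x : ℝ} (hu : 0 < u) (hx : 0 < x) :
    powLog j k (u * x) = ∑ p ∈ Finset.HasAntidiagonal.antidiagonal j,
      ((x ^ k * Real.log x ^ p.1 : ℝ) : ℂ) / (p.1 ! : ℂ) * powLog p.2 k u := by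
  rw [powLog, Real.log_mul hu.ne' hx.ne', add_comm (Real.log u), expSeries_add, mul_left_comm,
    coeff_mul, Finset.mul_sum]
  refine Finset.sum_congr rfl fun p _ => ?_
  rw [powLog, expSeries, coeff_mk]
  push_cast
  ring

lemma powLog_diffQuot (j k : ℕ) {u x : ℝ} (hu : 0 < u) (hx : 0 < x) :
    (powLog j k (u * x) - powLog j k u) / (1 - x) =
      ∑ p ∈ Finset.HasAntidiagonal.antidiagonal j,
        (psiKernel k p.1 x : ℂ) * (powLog p.2 k u / (p.1 ! : ℂ)) := by
  -- The subtracted `1` in `psiKernel` is present only for index `0`, so the single term `powLog j k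
  -- u` is spread over the antidiagonal.
  have h : powLog j k u = ∑ p ∈ Finset.HasAntidiagonal.antidiagonal j,
      (if p.1 = 0 then 1 else 0) / (p.1 ! : ℂ) * powLog p.2 k u := by
    rw [Finset.sum_eq_single (0, j)]
    · simp
    · rintro ⟨a, b⟩ hab hne
      have ha : a ≠ 0 := by
        rintro rfl
        simp only [Finset.HasAntidiagonal.mem_antidiagonal, zero_add] at hab
        exact hne (by rw [hab])
      simp [ha]
    · simp
  conv_lhs => rw [h]
  rw [powLog_mul j k hu hx, ← Finset.sum_sub_distrib, Finset.sum_div]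
  refine Finset.sum_congr rfl fun p _ => ?_
  rw [psiKernel]
  push_cast
  split_ifs <;> push_cast <;> ring

lemma intervalIntegrable_psiKernel_ofReal (k a : ℕ) :
    IntervalIntegrable (fun x => (psiKernel k a x : ℂ)) volume 0 1 :=
  ⟨(intervalIntegrable_psiKernel k a).1.ofReal, (intervalIntegrable_psiKernel k a).2.ofReal⟩

lemma intervalIntegrable_diffQuot (j k : ℕ) {u : ℝ} (hu : 0 < u) :
    IntervalIntegrable (fun x : ℝ => (powLog j k (u * x) - powLog j k u) / (1 - x))
      volume 0 1 := by
  have h : IntervalIntegrable (fun x : ℝ => ∑ p ∈ Finset.HasAntidiagonal.antidiagonal j,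
        (psiKernel k p.1 x : ℂ) * (powLog p.2 k u / (p.1 ! : ℂ))) volume 0 1 :=
    by
      simpa only [Finset.sum_fn] using IntervalIntegrable.sum _ fun p _ =>
        IntervalIntegrable.mul_const (intervalIntegrable_psiKernel_ofReal k p.1)
          (powLog p.2 k u / (p.1 ! : ℂ))
  refine h.congr fun x hx => ?_
  rw [Set.uIoc_of_le zero_le_one] at hx
  exact (powLog_diffQuot j k hu hx.1).symm

/-- Differentiating `e^{-γz} u^{k+z}/Γ(k+1+z)` in `z` multiplies it by `log u` plus the integral
`psiFun k z`. The factor `j + 1` comes from reading the coefficient of `z^j` in a derivative. -/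
lemma log_mul_powLog_add_integral (j k : ℕ) {u : ℝ} (hu : 0 < u) :
    (Real.log u : ℂ) * powLog j k u +
      ∫ x in (0 : ℝ)..1, (powLog j k (u * x) - powLog j k u) / (1 - x) =
      (j + 1) * powLog (j + 1) k u := by
  have h1 : ∫ x in (0 : ℝ)..1, (powLog j k (u * x) - powLog j k u) / (1 - x) =
      (u : ℂ) ^ k * coeff j (psiSeries k * (gammaSeries k * expSeries (Real.log u))) := by
    rw [intervalIntegral.integral_congr_ae (g := fun x : ℝ =>
      ∑ p ∈ Finset.HasAntidiagonal.antidiagonal j,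
        (psiKernel k p.1 x : ℂ) * (powLog p.2 k u / (p.1 ! : ℂ)))
      (ae_uIoc_zero_one fun x h0 _ => powLog_diffQuot j k hu h0)]
    rw [intervalIntegral.integral_finsetSum fun p _ =>
      IntervalIntegrable.mul_const (intervalIntegrable_psiKernel_ofReal k p.1) _, coeff_mul,
      Finset.mul_sum]
    refine Finset.sum_congr rfl fun p _ => ?_
    rw [intervalIntegral.integral_mul_const, intervalIntegral.integral_ofReal, psiSeries, coeff_mk,
      powLog, psiCoeff]
    ring
  have h2 : (j + 1 : ℂ) * coeff (j + 1) (gammaSeries k * expSeries (Real.log u)) =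
      coeff j (psiSeries k * (gammaSeries k * expSeries (Real.log u))) +
        (Real.log u : ℂ) * coeff j (gammaSeries k * expSeries (Real.log u)) := by
    rw [← coeff_C_mul j _ (Real.log u : ℂ), ← map_add, mul_comm, ← coeff_derivative, Derivation.leibniz,
      derivative_gammaSeries, derivative_expSeries, smul_eq_mul, smul_eq_mul]
    congr 1
    ring
  rw [h1, powLog, powLog, mul_left_comm ((j : ℂ) + 1), h2]
  ring

/-! ### Size of the coefficients and Taylor expansion in `u`. -/

lemma log_exp_one_mul {u : ℝ} (hu : 0 < u) :
    Real.log (Real.exp 1 * u) = 1 + Real.log u := by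
  rw [Real.log_mul (Real.exp_pos 1).ne' hu.ne', Real.log_exp]

lemma one_le_log_exp_one_mul {u : ℝ} (hu : 1 ≤ u) : 1 ≤ Real.log (Real.exp 1 * u) := by
  rw [log_exp_one_mul (by linarith)]
  linarith [Real.log_nonneg hu]

lemma norm_coeff_mul_expSeries_le (p : PowerSeries ℂ) (j : ℕ) :
    ∃ M : ℝ, 0 ≤ M ∧ ∀ u : ℝ, 1 ≤ u →
      ‖coeff j (p * expSeries (Real.log u))‖ ≤ M * Real.log (Real.exp 1 * u) ^ j := by
  refine ⟨∑ q ∈ Finset.HasAntidiagonal.antidiagonal j, ‖coeff q.1 p‖,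
    Finset.sum_nonneg fun _ _ => norm_nonneg _, fun u hu => ?_⟩
  rw [coeff_mul, Finset.sum_mul]
  refine (norm_sum_le _ _).trans (Finset.sum_le_sum fun q hq => ?_)
  rw [norm_mul]
  refine mul_le_mul_of_nonneg_left ?_ (norm_nonneg _)
  have h0 := Real.log_nonneg hu
  have h1 := one_le_log_exp_one_mul hu
  rw [expSeries, coeff_mk, norm_div, norm_pow, Complex.norm_natCast, Complex.norm_real,
    Real.norm_of_nonneg h0]
  calc Real.log u ^ q.2 / (q.2 ! : ℝ) ≤ Real.log u ^ q.2 :=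
        div_le_self (by positivity) (by exact_mod_cast q.2.factorial_pos)
    _ ≤ Real.log (Real.exp 1 * u) ^ q.2 := by
        rw [log_exp_one_mul (by linarith)]
        exact pow_le_pow_left₀ h0 (by linarith) _
    _ ≤ Real.log (Real.exp 1 * u) ^ j :=
        pow_le_pow_right₀ h1 (by
          have := Finset.HasAntidiagonal.mem_antidiagonal.mp hq
          omega)

lemma norm_powLogTail_le (j : ℕ) :
    ∃ M : ℝ, 0 ≤ M ∧ ∀ u : ℝ, 1 ≤ u →
      ‖powLogTail j u‖ ≤ M * Real.log (Real.exp 1 * u) ^ j / u := by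
  obtain ⟨M, hM, h⟩ := norm_coeff_mul_expSeries_le (X * gammaSeries 0) j
  refine ⟨M, hM, fun u hu => ?_⟩
  have hu0 : 0 < u := by linarith
  rw [powLogTail, norm_mul, norm_inv, Complex.norm_real, Real.norm_of_nonneg hu0.le,
    inv_mul_eq_div, ← mul_assoc]
  gcongr
  exact h u hu

/-- The Taylor polynomial of `powLog j k` at `u`, evaluated at `u - t`. -/
noncomputable def powLogTaylor (j k : ℕ) (u t : ℝ) : ℂ :=
  ∑ n ∈ Finset.range (k + 1), (-(t : ℂ)) ^ n / (n ! : ℂ) * powLog j (k - n) u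

lemma hasDerivAt_powLogTaylor_succ (j k : ℕ) (u t : ℝ) :
    HasDerivAt (powLogTaylor j (k + 1) u) (-powLogTaylor j k u t) t := by
  have h : ∀ n : ℕ, HasDerivAt (fun t : ℝ => (-(t : ℂ)) ^ (n + 1) / ((n + 1)! : ℂ))
      (-((-(t : ℂ)) ^ n / (n ! : ℂ))) t := fun n => by
    have h0 := (((hasDerivAt_id (t : ℂ)).neg.pow (n + 1)).div_const ((n + 1)! : ℂ)).comp_ofReal
    convert! h0 using 1
    have h1 : (n ! : ℂ) ≠ 0 := Nat.cast_ne_zero.mpr n.factorial_ne_zero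
    have h2 : ((n : ℂ) + 1) ≠ 0 := Nat.cast_add_one_ne_zero n
    rw [Nat.factorial_succ]
    push_cast
    simp only [Pi.neg_apply, id]
    field_simp
  have hfun : powLogTaylor j (k + 1) u = fun t : ℝ =>
      (∑ n ∈ Finset.range (k + 1), (-(t : ℂ)) ^ (n + 1) / ((n + 1)! : ℂ) * powLog j (k - n) u) +
        powLog j (k + 1) u := by
    ext t
    rw [powLogTaylor, Finset.sum_range_succ']
    simp
  rw [hfun, powLogTaylor, ← Finset.sum_neg_distrib]
  refine HasDerivAt.add_const _ (HasDerivAt.fun_sum fun n _ => ?_)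
  rw [← neg_mul]
  exact (h n).mul_const _

/-- The `t`-derivative of the remainder for `k + 1` is minus the remainder for `k`, so the bound
climbs by the mean value inequality. It starts from the derivative of `powLog j 0`, the only one
that leaves the family. -/
lemma norm_powLog_sub_taylor_le (j k : ℕ) {u N : ℝ} (hu : 2 ≤ u)
    (hN : ∀ v ∈ Set.Icc (u - 1) u, ‖powLogTail j v‖ ≤ N) :
    ∀ t ∈ Set.Icc (0 : ℝ) 1, ‖powLog j k (u - t) - powLogTaylor j k u t‖ ≤ N * t ^ (k + 1) := by
  have hN0 : 0 ≤ N := (norm_nonneg _).trans (hN u ⟨by linarith, le_rfl⟩)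
  induction k with
  | zero =>
    intro t ht
    have h := Convex.norm_image_sub_le_of_norm_hasDerivWithin_le (f := fun t => powLog j 0 (u - t))
      (f' := fun t => -powLogTail j (u - t)) (s := Set.Icc 0 1) (C := N) (x := 0) (y := t)
      (fun x hx => ((hasDerivAt_powLog_zero j (by linarith [hx.2])).comp_const_sub u
        x).hasDerivWithinAt)
      (fun x hx => by
        rw [norm_neg]; exact hN _ ⟨by linarith [hx.2], by linarith [hx.1]⟩)
      (convex_Icc 0 1) ⟨le_rfl, zero_le_one⟩ ht
    simpa [powLogTaylor, abs_of_nonneg ht.1] using h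
  | succ k ih =>
    intro t ht
    have h := Convex.norm_image_sub_le_of_norm_hasDerivWithin_le
      (f := fun t => powLog j (k + 1) (u - t) - powLogTaylor j (k + 1) u t)
      (f' := fun t => -powLog j k (u - t) - -powLogTaylor j k u t) (s := Set.Icc 0 t)
      (C := N * t ^ (k + 1)) (x := 0) (y := t)
      (fun x hx => (((hasDerivAt_powLog_succ j k (by linarith [hx.2, ht.2])).comp_const_sub u
        x).sub (hasDerivAt_powLogTaylor_succ j k u x)).hasDerivWithinAt)
      (fun x hx => by
        rw [neg_sub_neg, ← norm_neg, neg_sub]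
        refine (ih x ⟨hx.1, hx.2.trans ht.2⟩).trans ?_
        have := hx.1
        have := hx.2
        gcongr)
      (convex_Icc 0 t) ⟨le_rfl, ht.1⟩ ⟨ht.1, le_rfl⟩
    have h0 : powLogTaylor j (k + 1) u 0 = powLog j (k + 1) u := by
      rw [powLogTaylor, Finset.sum_range_succ']
      simp
    simp only [sub_zero, h0, sub_self, Real.norm_of_nonneg ht.1] at h
    rwa [pow_succ, ← mul_assoc]

/-! ### The integral operator applied to `powLog`. -/

lemma integral_one_div_one_sub {u : ℝ} (hu : 1 ≤ u) :
    ∫ x in (0 : ℝ)..(1 - 1 / u), 1 / (1 - x) = Real.log u := by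
  have hu0 : 0 < u := by linarith
  rw [intervalIntegral.integral_comp_sub_left (fun y => 1 / y) 1, sub_sub_cancel, sub_zero,
    integral_one_div_of_pos (by positivity) one_pos]
  simp

/-- Formally `∫_0^1 (e^{-tD} - 1)/t dt = -Ein(D)` with `D = d/du`, truncated where `D` would lower
the exponent below `0`. -/
lemma norm_integral_near_le (j k : ℕ) {u N : ℝ} (hu : 2 ≤ u)
    (hN : ∀ v ∈ Set.Icc (u - 1) u, ‖powLogTail j v‖ ≤ N) :
    ‖(∫ t in (0 : ℝ)..1, (powLog j k (u - t) - powLog j k u) / (t : ℂ)) +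
      ∑ n ∈ Finset.range (k + 1), einCoeff n * powLog j (k - n) u‖ ≤ N := by
  have hN0 : 0 ≤ N := (norm_nonneg _).trans (hN u ⟨by linarith, le_rfl⟩)
  -- `Q` is the Taylor polynomial without its constant term, divided by `t`; its integral is
  -- computed exactly and `h` is the remainder divided by `t`.
  set Q : ℝ → ℂ := fun t => ∑ n ∈ Finset.range k,
    (-1) ^ (n + 1) * (t : ℂ) ^ n / ((n + 1)! : ℂ) * powLog j (k - (n + 1)) u with hQ
  set h : ℝ → ℂ := fun t => (powLog j k (u - t) - powLog j k u) / (t : ℂ) - Q t with hh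
  have hQc : Continuous Q := by rw [hQ]; fun_prop
  have hQint : ∫ t in (0 : ℝ)..1, Q t =
      -∑ n ∈ Finset.range (k + 1), einCoeff n * powLog j (k - n) u := by
    rw [Finset.sum_range_succ', hQ, intervalIntegral.integral_finsetSum fun n _ =>
      (Continuous.intervalIntegrable (by fun_prop) 0 1)]
    rw [show einCoeff 0 = 0 by simp [einCoeff], zero_mul, add_zero, ← Finset.sum_neg_distrib]
    refine Finset.sum_congr rfl fun n _ => ?_
    rw [intervalIntegral.integral_mul_const, intervalIntegral.integral_div,
      intervalIntegral.integral_const_mul]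
    have : ∫ t in (0 : ℝ)..1, (t : ℂ) ^ n = 1 / (n + 1) := by
      simp_rw [← Complex.ofReal_pow]
      rw [intervalIntegral.integral_ofReal, integral_pow]
      push_cast
      simp
    rw [this, einCoeff, if_neg (Nat.succ_ne_zero n)]
    push_cast
    field_simp
  have hbound : ∀ t ∈ Set.uIoc (0 : ℝ) 1, ‖h t‖ ≤ N := by
    intro t ht
    rw [Set.uIoc_of_le zero_le_one] at ht
    have ht0 : (t : ℂ) ≠ 0 := by exact_mod_cast ht.1.ne'
    have e : h t = (powLog j k (u - t) - powLogTaylor j k u t) / (t : ℂ) := by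
      rw [hh, hQ, powLogTaylor, Finset.sum_range_succ', eq_div_iff ht0, sub_mul,
        div_mul_cancel₀ _ ht0, Finset.sum_mul]
      simp only [pow_zero, Nat.factorial_zero, Nat.cast_one, div_one, one_mul, Nat.sub_zero]
      rw [add_comm, ← sub_sub]
      congr 1
      refine Finset.sum_congr rfl fun n _ => ?_
      rw [neg_pow (t : ℂ), pow_succ (t : ℂ)]
      ring
    rw [e, norm_div, Complex.norm_real, Real.norm_of_nonneg ht.1.le, div_le_iff₀ ht.1]
    refine (norm_powLog_sub_taylor_le j k hu hN t ⟨ht.1.le, ht.2⟩).trans ?_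
    gcongr
    exact pow_le_of_le_one ht.1.le ht.2 (Nat.succ_ne_zero k)
  have hcont : ContinuousOn h (Set.Ioc 0 1) := by
    refine ContinuousOn.sub (ContinuousOn.div (ContinuousOn.sub ?_ continuousOn_const)
      (by fun_prop) ?_) hQc.continuousOn
    · exact (continuousOn_powLog j k).comp (by fun_prop) fun t ht =>
        show 0 < u - t by linarith [ht.2]
    · intro t ht
      exact_mod_cast ht.1.ne'
  have hint : IntervalIntegrable h volume 0 1 := by
    refine (intervalIntegrable_const (c := N)).mono_fun' ?_ ?_
    · rw [Set.uIoc_of_le zero_le_one]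
      exact hcont.aestronglyMeasurable measurableSet_Ioc
    · rw [EventuallyLE, ae_restrict_iff' measurableSet_uIoc]
      exact ae_of_all _ hbound
  have hsplit : ∫ t in (0 : ℝ)..1, (powLog j k (u - t) - powLog j k u) / (t : ℂ) =
      (∫ t in (0 : ℝ)..1, h t) + ∫ t in (0 : ℝ)..1, Q t := by
    rw [← intervalIntegral.integral_add hint (hQc.intervalIntegrable 0 1)]
    simp [hh]
  rw [hsplit, hQint, neg_add_cancel_right]
  simpa using intervalIntegral.norm_integral_le_of_norm_le_const hbound

lemma intervalIntegrable_powLog_scaled (j k : ℕ) {u : ℝ} (hu : 1 ≤ u) :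
    IntervalIntegrable (fun x : ℝ => powLog j k (u * x) / (1 - (x : ℂ))) volume 0 (1 - 1 / u) ∧
    ∫ x in (0 : ℝ)..(1 - 1 / u), powLog j k (u * x) / (1 - (x : ℂ)) =
      (Real.log u : ℂ) * powLog j k u +
      ∫ x in (0 : ℝ)..(1 - 1 / u), (powLog j k (u * x) - powLog j k u) / (1 - (x : ℂ)) := by
  have hu0 : 0 < u := by linarith
  have hle : 1 / u ≤ 1 := by rw [div_le_one hu0]; exact hu
  have hpos : 0 < 1 / u := by positivity
  have hsub : Set.uIcc (0 : ℝ) (1 - 1 / u) ⊆ Set.uIcc 0 1 := by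
    rw [Set.uIcc_of_le (by linarith), Set.uIcc_of_le zero_le_one]
    exact Set.Icc_subset_Icc le_rfl (by linarith)
  have h1 := (intervalIntegrable_diffQuot j k hu0).mono_set hsub
  have h2r : IntervalIntegrable (fun x : ℝ => 1 / (1 - x)) volume 0 (1 - 1 / u) := by
    refine ContinuousOn.intervalIntegrable ?_
    refine ContinuousOn.div (by fun_prop) (by fun_prop) fun x hx => ?_
    rw [Set.uIcc_of_le (by linarith)] at hx
    linarith [hx.2]
  have h2 : IntervalIntegrable (fun x : ℝ => ((1 / (1 - x) : ℝ) : ℂ) * powLog j k u)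
      volume 0 (1 - 1 / u) :=
    IntervalIntegrable.mul_const ⟨h2r.1.ofReal, h2r.2.ofReal⟩ _
  have hfun : (fun x : ℝ => powLog j k (u * x) / (1 - (x : ℂ))) = fun x : ℝ =>
      ((1 / (1 - x) : ℝ) : ℂ) * powLog j k u +
        (powLog j k (u * x) - powLog j k u) / (1 - (x : ℂ)) := by
    ext x; push_cast; ring
  rw [hfun]
  refine ⟨h2.add h1, ?_⟩
  rw [intervalIntegral.integral_add h2 h1, intervalIntegral.integral_mul_const,
    intervalIntegral.integral_ofReal, integral_one_div_one_sub hu]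

lemma intervalIntegrable_powLog_div (j k : ℕ) {u : ℝ} (hu : 1 ≤ u) :
    IntervalIntegrable (fun v : ℝ => powLog j k v / ((u - v : ℝ) : ℂ)) volume 0 (u - 1) := by
  have hu0 : 0 < u := by linarith
  have hu' : (u : ℂ) ≠ 0 := by exact_mod_cast hu0.ne'
  have h := ((intervalIntegrable_powLog_scaled j k hu).1.comp_mul_left (c := u⁻¹)).const_mul
    ((u : ℂ)⁻¹)
  have e1 : (0 : ℝ) / u⁻¹ = 0 := by simp
  have e2 : (1 - 1 / u) / u⁻¹ = u - 1 := by field_simp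
  rw [e1, e2] at h
  refine h.congr fun v hv => ?_
  rw [Set.uIoc_of_le (by linarith)] at hv
  have hne : (u : ℂ) - v ≠ 0 := by exact_mod_cast (by linarith [hv.2] : (0 : ℝ) < u - v).ne'
  have hne2 : 1 - (u : ℂ)⁻¹ * v ≠ 0 := by
    intro h0
    apply hne
    field_simp at h0
    simpa using h0
  simp only [mul_inv_cancel_left₀ hu0.ne']
  push_cast
  field_simp

/-- The operator acts as `d/dz + Ein(d/du)`. The constant can be chosen before `k`, since the error
only involves the derivative of `powLog j 0`. -/
lemma integral_powLog_div (j : ℕ) : ∃ M : ℝ, 0 ≤ M ∧ ∀ k : ℕ, ∀ u : ℝ, 2 ≤ u →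
    ‖(∫ v in (0 : ℝ)..(u - 1), powLog j k v / ((u - v : ℝ) : ℂ)) -
      ((j + 1) * powLog (j + 1) k u +
        ∑ n ∈ Finset.range (k + 1), einCoeff n * powLog j (k - n) u)‖ ≤
      M * (Real.log (Real.exp 1 * u) ^ j / u) := by
  obtain ⟨M, hM, hT⟩ := norm_powLogTail_le j
  refine ⟨2 * M, by positivity, fun k u hu => ?_⟩
  have hu0 : 0 < u := by linarith
  have hu1 : 1 ≤ u := by linarith
  have hu' : (u : ℂ) ≠ 0 := by exact_mod_cast hu0.ne'
  have hle : 1 / u ≤ 1 := by rw [div_le_one hu0]; exact hu1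
  -- The factor `2` comes from `v ≥ u - 1 ≥ u/2`.
  have hN : ∀ v ∈ Set.Icc (u - 1) u,
      ‖powLogTail j v‖ ≤ 2 * M * (Real.log (Real.exp 1 * u) ^ j / u) := by
    intro v hv
    have hv1 : 1 ≤ v := by linarith [hv.1]
    have hlog := one_le_log_exp_one_mul hv1
    refine (hT v hv1).trans ?_
    calc M * Real.log (Real.exp 1 * v) ^ j / v
        ≤ M * Real.log (Real.exp 1 * u) ^ j / (u / 2) := by
          have : Real.exp 1 * v ≤ Real.exp 1 * u :=
            mul_le_mul_of_nonneg_left hv.2 (Real.exp_pos 1).le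
          have hev : 0 < Real.exp 1 * v := by positivity
          have huv : u / 2 ≤ v := by linarith [hv.1]
          have hlogle := Real.log_le_log hev this
          have hpos : 0 ≤ Real.log (Real.exp 1 * u) := by linarith
          gcongr
      _ = 2 * M * (Real.log (Real.exp 1 * u) ^ j / u) := by field_simp
  have h1 : ∫ v in (0 : ℝ)..(u - 1), powLog j k v / ((u - v : ℝ) : ℂ) =
      ∫ x in (0 : ℝ)..(1 - 1 / u), powLog j k (u * x) / (1 - (x : ℂ)) := by
    have h := intervalIntegral.smul_integral_comp_mul_left (a := 0) (b := 1 - 1 / u)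
      (fun v : ℝ => powLog j k v / ((u - v : ℝ) : ℂ)) u
    have e : u * (1 - 1 / u) = u - 1 := by field_simp
    rw [mul_zero, e] at h
    rw [← h, Complex.real_smul, ← intervalIntegral.integral_const_mul]
    congr 1
    ext x
    rw [show u - u * x = u * (1 - x) by ring]
    push_cast
    rw [mul_div_assoc', mul_div_mul_left _ _ hu']
  -- The piece from `1 - 1/u` to `1`, added to reach the full integral, becomes an integral over
  -- `[0,1]` under `x = 1 - t/u`.
  have h2 : ∫ x in (0 : ℝ)..1, (powLog j k (u * x) - powLog j k u) / (1 - (x : ℂ)) =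
      (∫ x in (0 : ℝ)..(1 - 1 / u), (powLog j k (u * x) - powLog j k u) / (1 - (x : ℂ))) +
      ∫ t in (0 : ℝ)..1, (powLog j k (u - t) - powLog j k u) / (t : ℂ) := by
    have hd := intervalIntegrable_diffQuot j k hu0
    have hpos : 0 < 1 / u := by positivity
    rw [← intervalIntegral.integral_add_adjacent_intervals (b := 1 - 1 / u)
      (hd.mono_set (by
        rw [Set.uIcc_of_le (by linarith), Set.uIcc_of_le zero_le_one]
        exact Set.Icc_subset_Icc le_rfl (by linarith)))
      (hd.mono_set (by
        rw [Set.uIcc_of_le (by linarith), Set.uIcc_of_le zero_le_one]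
        exact Set.Icc_subset_Icc (by linarith) le_rfl))]
    congr 1
    have h := intervalIntegral.integral_comp_sub_div (a := 0) (b := 1)
      (fun x : ℝ => (powLog j k (u * x) - powLog j k u) / (1 - (x : ℂ))) hu0.ne' 1
    rw [zero_div, sub_zero] at h
    have h' : ∫ x in (1 - 1 / u)..1, (powLog j k (u * x) - powLog j k u) / (1 - (x : ℂ)) =
        (u : ℂ)⁻¹ * ∫ t in (0 : ℝ)..1, (powLog j k (u * (1 - t / u)) - powLog j k u) /
          (1 - ((1 - t / u : ℝ) : ℂ)) := by
      rw [h, Complex.real_smul, inv_mul_cancel_left₀ hu']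
    rw [h', ← intervalIntegral.integral_const_mul]
    congr 1
    ext t
    rw [show u * (1 - t / u) = u - t by field_simp]
    push_cast
    rw [sub_sub_cancel]
    field_simp
  have h3 := log_mul_powLog_add_integral j k hu0
  have h4 := norm_integral_near_le j k hu hN
  rw [h1, (intervalIntegrable_powLog_scaled j k hu1).2, ← h3, h2]
  rw [← norm_neg] at h4
  refine (le_of_eq ?_).trans h4
  congr 1
  ring

/-! ### The recursion for `K`. -/

/-- The domain of integration of `K l u k`. -/
def simplexSet (l : ℕ) (u : ℝ) : Set (Fin l → ℝ) := {t | (∀ i, 1 ≤ t i) ∧ ∑ i, t i ≤ u}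

/-- The integrand of `K l u k`, extended by zero. -/
noncomputable def simplexFun (l : ℕ) (u : ℝ) (k : ℕ) : (Fin l → ℝ) → ℝ :=
  (simplexSet l u).indicator fun t => (u - ∑ i, t i) ^ k * ∏ i, (1 / t i)

lemma measurableSet_simplexSet (l : ℕ) (u : ℝ) : MeasurableSet (simplexSet l u) := by
  have h1 : MeasurableSet {t : Fin l → ℝ | ∀ i, 1 ≤ t i} := by
    rw [Set.ofPred_forall]
    exact MeasurableSet.iInter fun i => measurableSet_le measurable_const (measurable_pi_apply i)
  exact h1.inter (measurableSet_le (f := fun t : Fin l → ℝ => ∑ i, t i) (by fun_prop) measurable_const)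

lemma K_eq_integral (l : ℕ) (u : ℝ) (k : ℕ) :
    (l ! : ℝ) * K l u k = ∫ t, simplexFun l u k t := by
  have h : (l ! : ℝ) ≠ 0 := Nat.cast_ne_zero.mpr l.factorial_ne_zero
  simp only [simplexFun]
  rw [integral_indicator (measurableSet_simplexSet l u), K, ← mul_assoc, mul_one_div_cancel h,
    one_mul]
  rfl

lemma integrable_simplexFun (l : ℕ) (u : ℝ) (k : ℕ) : Integrable (simplexFun l u k) := by
  unfold simplexFun
  rw [integrable_indicator_iff (measurableSet_simplexSet l u)]
  have hsub : simplexSet l u ⊆ Set.Icc (fun _ => 1) (fun _ => u) := fun t ht =>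
    ⟨fun i => ht.1 i, fun i => (Finset.single_le_sum (f := t)
      (fun j _ => zero_le_one.trans (ht.1 j)) (Finset.mem_univ i)).trans ht.2⟩
  have hfin : volume (simplexSet l u) ≠ ⊤ :=
    ((measure_mono hsub).trans_lt isCompact_Icc.measure_lt_top).ne
  refine Measure.integrableOn_of_bounded (M := |u| ^ k) hfin
    (Measurable.aestronglyMeasurable (by fun_prop)) ?_
  rw [ae_restrict_iff' (measurableSet_simplexSet l u)]
  refine ae_of_all _ fun t ht => ?_
  have hs : 0 ≤ ∑ i, t i := Finset.sum_nonneg fun i _ => zero_le_one.trans (ht.1 i)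
  have h1 : |u - ∑ i, t i| ≤ |u| := by
    rw [abs_of_nonneg (by linarith [ht.2]), abs_of_nonneg (by linarith [ht.2])]
    linarith
  have h2 : |∏ i, (1 / t i)| ≤ 1 := by
    rw [Finset.abs_prod]
    refine Finset.prod_le_one (fun i _ => abs_nonneg _) fun i _ => ?_
    have := ht.1 i
    rw [abs_of_nonneg (by positivity), div_le_one (by linarith)]
    exact this
  rw [Real.norm_eq_abs, abs_mul, abs_pow]
  calc |u - ∑ i, t i| ^ k * |∏ i, (1 / t i)| ≤ |u| ^ k * 1 := by gcongr
    _ = |u| ^ k := mul_one _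

lemma simplexFun_succ (l : ℕ) (u : ℝ) (k : ℕ) (s : ℝ) (t : Fin l → ℝ) :
    simplexFun (l + 1) u k (Fin.cons s t) =
      (Set.Ici (1 : ℝ)).indicator (fun s => 1 / s) s * simplexFun l (u - s) k t := by
  have hmem : (Fin.cons s t : Fin (l + 1) → ℝ) ∈ simplexSet (l + 1) u ↔
      s ∈ Set.Ici (1 : ℝ) ∧ t ∈ simplexSet l (u - s) := by
    simp only [simplexSet, Set.mem_ofPred_eq, Fin.forall_fin_succ, Fin.sum_univ_succ, Fin.cons_zero,
      Fin.cons_succ, Set.mem_Ici, le_sub_iff_add_le, add_comm s, and_assoc]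
  unfold simplexFun
  by_cases hs : s ∈ Set.Ici (1 : ℝ)
  · by_cases ht : t ∈ simplexSet l (u - s)
    · rw [Set.indicator_of_mem (hmem.mpr ⟨hs, ht⟩), Set.indicator_of_mem hs,
        Set.indicator_of_mem ht]
      simp only [Fin.sum_univ_succ, Fin.prod_univ_succ, Fin.cons_zero, Fin.cons_succ, sub_sub]
      ring
    · rw [Set.indicator_of_notMem (fun h => ht (hmem.mp h).2), Set.indicator_of_notMem ht,
        mul_zero]
  · rw [Set.indicator_of_notMem (fun h => hs (hmem.mp h).1), Set.indicator_of_notMem hs, zero_mul]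

/-- Fubini in the first coordinate; the factor `l + 1` is the quotient of the two factorials. -/
lemma K_succ_Ici (l : ℕ) (u : ℝ) (k : ℕ) :
    Integrable ((Set.Ici (1 : ℝ)).indicator fun s => K l (u - s) k / s) ∧
    (l + 1 : ℝ) * K (l + 1) u k = ∫ s, (Set.Ici (1 : ℝ)).indicator (fun s => K l (u - s) k / s) s
    := by
  have hl : (l ! : ℝ) ≠ 0 := Nat.cast_ne_zero.mpr l.factorial_ne_zero
  have hmp := (volume_preserving_piFinSuccAbove (fun _ : Fin (l + 1) => ℝ) 0).symm
  have hint := (hmp.integrable_comp_emb (MeasurableEquiv.measurableEmbedding _)).mpr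
    (integrable_simplexFun (l + 1) u k)
  have hval := hmp.integral_comp (MeasurableEquiv.measurableEmbedding _) (simplexFun (l + 1) u k)
  have hfun : (simplexFun (l + 1) u k ∘
      (MeasurableEquiv.piFinSuccAbove (fun _ : Fin (l + 1) => ℝ) 0).symm) = fun p =>
        (Set.Ici (1 : ℝ)).indicator (fun s => 1 / s) p.1 * simplexFun l (u - p.1) k p.2 := by
    ext p
    rw [← simplexFun_succ]
    simp [Fin.insertNthEquiv]
  rw [hfun] at hint
  have hinner : (fun s : ℝ => ∫ t, (Set.Ici (1 : ℝ)).indicator (fun s => 1 / s) s *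
      simplexFun l (u - s) k t) =
      fun s => (l ! : ℝ) * (Set.Ici (1 : ℝ)).indicator (fun s => K l (u - s) k / s) s := by
    ext s
    rw [integral_const_mul, ← K_eq_integral]
    by_cases hs : s ∈ Set.Ici (1 : ℝ)
    · rw [Set.indicator_of_mem hs, Set.indicator_of_mem hs]; ring
    · rw [Set.indicator_of_notMem hs, Set.indicator_of_notMem hs]; ring
  have hleft := hint.integral_prod_left
  rw [hinner] at hleft
  refine ⟨?_, ?_⟩
  · have := hleft.const_mul (l ! : ℝ)⁻¹
    simpa only [inv_mul_cancel_left₀ hl] using this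
  · have h1 : ∫ p, simplexFun (l + 1) u k
        ((MeasurableEquiv.piFinSuccAbove (fun _ : Fin (l + 1) => ℝ) 0).symm p) =
        ∫ s, (l ! : ℝ) * (Set.Ici (1 : ℝ)).indicator (fun s => K l (u - s) k / s) s := by
      rw [← hinner, ← integral_prod _ hint, ← hfun]
      rfl
    rw [h1, integral_const_mul, ← K_eq_integral, Nat.factorial_succ] at hval
    push_cast at hval
    have : (l ! : ℝ) * ((l + 1 : ℝ) * K (l + 1) u k) = (l ! : ℝ) *
        ∫ s, (Set.Ici (1 : ℝ)).indicator (fun s => K l (u - s) k / s) s := by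
      rw [hval]; ring
    exact mul_left_cancel₀ hl this

lemma K_zero {u : ℝ} (hu : 0 ≤ u) (k : ℕ) : K 0 u k = u ^ k := by
  have h : {t : Fin 0 → ℝ | (∀ i, 1 ≤ t i) ∧ ∑ i, t i ≤ u} = Set.univ := by
    ext t; simp [hu]
  rw [K, h]
  rw [volume_pi, Measure.pi_of_empty _ (fun i => isEmptyElim i)]
  simp

/-- Used to cut the outer integral in the recursion at `s = u`. -/
lemma K_of_neg (l : ℕ) {u : ℝ} (hu : u < 0) (k : ℕ) : K l u k = 0 := by
  have h : {t : Fin l → ℝ | (∀ i, 1 ≤ t i) ∧ ∑ i, t i ≤ u} = ∅ := by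
    ext t
    simp only [Set.mem_ofPred_eq, Set.mem_empty_iff_false, iff_false, not_and, not_le]
    intro ht
    exact hu.trans_le (Finset.sum_nonneg fun i _ => zero_le_one.trans (ht i))
  rw [K, h]
  simp

lemma K_succ (l k : ℕ) {u : ℝ} (hu : 1 ≤ u) :
    IntervalIntegrable (fun v => K l v k / (u - v)) volume 0 (u - 1) ∧
    (l + 1 : ℝ) * K (l + 1) u k = ∫ v in (0 : ℝ)..(u - 1), K l v k / (u - v) := by
  obtain ⟨hi, hv⟩ := K_succ_Ici l u k
  have hind : (Set.Ici (1 : ℝ)).indicator (fun s => K l (u - s) k / s) =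
      (Set.Icc (1 : ℝ) u).indicator (fun s => K l (u - s) k / s) := by
    ext s
    by_cases h1 : s ∈ Set.Ici (1 : ℝ)
    · by_cases h2 : s ≤ u
      · rw [Set.indicator_of_mem h1, Set.indicator_of_mem (Set.mem_Icc.mpr ⟨h1, h2⟩)]
      · rw [Set.indicator_of_mem h1, Set.indicator_of_notMem fun h => h2 h.2,
          K_of_neg l (by linarith), zero_div]
    · rw [Set.indicator_of_notMem h1, Set.indicator_of_notMem fun h => h1 h.1]
  rw [hind] at hi hv
  rw [integrable_indicator_iff measurableSet_Icc] at hi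
  rw [integral_indicator measurableSet_Icc, integral_Icc_eq_integral_Ioc,
    ← intervalIntegral.integral_of_le hu] at hv
  have hi' : IntervalIntegrable (fun s => K l (u - s) k / s) volume 1 u := by
    rw [intervalIntegrable_iff_integrableOn_Icc_of_le hu]; exact hi
  have hcomp : (fun v => K l v k / (u - v)) = fun v => K l (u - (u - v)) k / (u - v) := by
    ext v; rw [sub_sub_cancel]
  refine ⟨?_, ?_⟩
  · have := (hi'.comp_sub_left u).symm
    rw [sub_self] at this
    rw [hcomp]
    exact this
  · rw [hv, hcomp, intervalIntegral.integral_comp_sub_left (fun s => K l (u - s) k / s) u]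
    simp

/-! ### The main term and its recursion. -/

/-- The sum over `n` in the main term, for fixed `m`. -/
noncomputable def mainRow (k j m : ℕ) (u : ℝ) : ℂ :=
  ∑ n ∈ Finset.range (k + 1), E n m * powLog j (k - n) u

/-- The main term of `K l u k`. -/
noncomputable def mainTerm (l k : ℕ) (u : ℝ) : ℂ :=
  (k ! : ℂ) * ∑ m ∈ Finset.range (l + 1), mainRow k (l - m) m u / (m ! : ℂ)

lemma mainTerm_zero (k : ℕ) (u : ℝ) : mainTerm 0 k u = (u : ℂ) ^ k := by
  have hk : (k ! : ℂ) ≠ 0 := Nat.cast_ne_zero.mpr k.factorial_ne_zero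
  simp only [mainTerm, mainRow, E_zero, zero_add, Finset.sum_range_one, Nat.sub_self,
    Nat.factorial_zero, Nat.cast_one, div_one, ite_mul, one_mul, zero_mul]
  rw [Finset.sum_ite_eq' _ 0, if_pos (by simp), Nat.sub_zero, powLog, coeff_mul]
  simp only [Finset.HasAntidiagonal.antidiagonal_zero, Finset.sum_singleton, coeff_zero_gammaSeries,
    expSeries, coeff_mk, pow_zero, Nat.factorial_zero]
  push_cast
  field_simp

lemma continuousOn_mainTerm (l k : ℕ) : ContinuousOn (mainTerm l k) (Set.Ioi 0) := by
  unfold mainTerm mainRow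
  refine continuousOn_const.mul (continuousOn_finsetSum _ fun m _ => ContinuousOn.div_const
    (continuousOn_finsetSum _ fun n _ => continuousOn_const.mul (continuousOn_powLog _ _)) _)

lemma mainTerm_eq_sum (l k : ℕ) (u : ℝ) :
    ∑ m ∈ Finset.range (min k l + 1), ∑ n ∈ Finset.Icc m k, ∑ r ∈ Finset.range (l - m + 1),
      D m n r k l * (u : ℂ) ^ (k - n) * ((Real.log u : ℝ) : ℂ) ^ (l - m - r) =
      mainTerm l k u := by
  have hinner : ∀ m n : ℕ, ∑ r ∈ Finset.range (l - m + 1),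
      D m n r k l * (u : ℂ) ^ (k - n) * ((Real.log u : ℝ) : ℂ) ^ (l - m - r) =
      (k ! : ℂ) * (E n m * powLog (l - m) (k - n) u / (m ! : ℂ)) := by
    intro m n
    rw [powLog_eq_sum, Finset.mul_sum, Finset.sum_div, Finset.mul_sum]
    refine Finset.sum_congr rfl fun r _ => ?_
    rw [D, Complex.Gamma_nat_eq_factorial]
    have h1 : (m ! : ℂ) ≠ 0 := Nat.cast_ne_zero.mpr m.factorial_ne_zero
    have h2 : ((l - m - r)! : ℂ) ≠ 0 := Nat.cast_ne_zero.mpr (Nat.factorial_ne_zero _)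
    field_simp
  simp only [hinner, mainTerm, mainRow, Finset.sum_div, Finset.mul_sum]
  have hrow : ∀ m : ℕ, ∑ n ∈ Finset.Icc m k,
      (k ! : ℂ) * (E n m * powLog (l - m) (k - n) u / (m ! : ℂ)) =
      ∑ n ∈ Finset.range (k + 1), (k ! : ℂ) * (E n m * powLog (l - m) (k - n) u / (m ! : ℂ)) := by
    intro m
    refine Finset.sum_subset (fun n hn => ?_) fun n hn hn' => ?_
    · simp only [Finset.mem_Icc, Finset.mem_range] at hn ⊢
      omega
    · simp only [Finset.mem_Icc, Finset.mem_range] at hn hn'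
      rw [E_eq_zero (by omega)]
      simp
  simp only [hrow]
  refine Finset.sum_subset (fun m hm => ?_) fun m hm hm' => Finset.sum_eq_zero fun n hn => ?_
  · simp only [Finset.mem_range] at hm ⊢
    omega
  · simp only [Finset.mem_range] at hm hm' hn
    rw [E_eq_zero (by omega)]
    simp

/-- This is `Ein(D)^m · Ein(D) = Ein(D)^{m+1}` with `D = d/du`; both sides are truncated at total
order `k`, so the sums match exactly. -/
lemma mainRow_succ (k j m : ℕ) (u : ℝ) :
    ∑ n ∈ Finset.range (k + 1), E n m * ∑ i ∈ Finset.range (k - n + 1),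
      einCoeff i * powLog j (k - n - i) u = mainRow k j (m + 1) u := by
  simp only [mainRow, E_succ, Finset.Nat.sum_antidiagonal_eq_sum_range_succ_mk, Finset.sum_mul,
    Finset.mul_sum]
  have h := Finset.sum_range_diag_flip (k + 1)
    fun a b => E a m * einCoeff b * powLog j (k - (a + b)) u
  refine Eq.trans ?_ (h.symm.trans ?_)
  · refine Finset.sum_congr rfl fun n hn => ?_
    have hn' := Finset.mem_range.mp hn
    rw [show k + 1 - n = k - n + 1 by omega]
    refine Finset.sum_congr rfl fun i _ => ?_
    rw [Nat.sub_sub, mul_assoc]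
  · refine Finset.sum_congr rfl fun n _ => Finset.sum_congr rfl fun i hi => ?_
    have hi' := Finset.mem_range.mp hi
    rw [show i + (n - i) = n by omega]

/-- The binomial recursion: a term with index `m` on the right arises with weight `l + 1 - m` from
the derivative in `z` and with weight `m` from `Ein(d/du)`, in total `l + 1`. -/
lemma sum_mainRow_succ (l k : ℕ) (u : ℝ) :
    (k ! : ℂ) * ∑ m ∈ Finset.range (l + 1), (((l - m : ℕ) + 1 : ℂ) * mainRow k (l - m + 1) m u +
      mainRow k (l - m) (m + 1) u) / (m ! : ℂ) = (l + 1) * mainTerm (l + 1) k u := by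
  rw [mainTerm, mul_left_comm]
  congr 1
  have h1 : ∀ m ∈ Finset.range (l + 1),
      (((l - m : ℕ) + 1 : ℂ) * mainRow k (l - m + 1) m u + mainRow k (l - m) (m + 1) u) /
        (m ! : ℂ) =
      (l + 1 - m : ℂ) * (mainRow k (l + 1 - m) m u / (m ! : ℂ)) +
      ((m + 1 : ℕ) : ℂ) * (mainRow k (l + 1 - (m + 1)) (m + 1) u / ((m + 1)! : ℂ)) := by
    intro m hm
    have hm' : m ≤ l := Nat.lt_succ_iff.mp (Finset.mem_range.mp hm)
    have h1 : (m ! : ℂ) ≠ 0 := Nat.cast_ne_zero.mpr m.factorial_ne_zero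
    have h2 : ((m : ℂ) + 1) ≠ 0 := Nat.cast_add_one_ne_zero m
    rw [show l + 1 - m = l - m + 1 by omega, show l + 1 - (m + 1) = l - m by omega,
      Nat.cast_sub hm', Nat.factorial_succ]
    push_cast
    field_simp
    ring
  -- The added term `m = l + 1` has weight `0`; so has the term `m = 0` added in `h3`.
  have h2 : ∑ m ∈ Finset.range (l + 1),
      (l + 1 - m : ℂ) * (mainRow k (l + 1 - m) m u / (m ! : ℂ)) =
      ∑ m ∈ Finset.range (l + 1 + 1),
        (l + 1 - m : ℂ) * (mainRow k (l + 1 - m) m u / (m ! : ℂ)) := by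
    rw [Finset.sum_range_succ _ (l + 1)]
    simp
  have h3 : ∑ m ∈ Finset.range (l + 1),
      ((m + 1 : ℕ) : ℂ) * (mainRow k (l + 1 - (m + 1)) (m + 1) u / ((m + 1)! : ℂ)) =
      ∑ m ∈ Finset.range (l + 1 + 1), (m : ℂ) * (mainRow k (l + 1 - m) m u / (m ! : ℂ)) := by
    rw [Finset.sum_range_succ' _ (l + 1)]
    simp
  rw [Finset.sum_congr rfl h1, Finset.sum_add_distrib, h2, h3, ← Finset.sum_add_distrib,
    Finset.mul_sum]
  refine Finset.sum_congr rfl fun m _ => ?_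
  ring

lemma intervalIntegrable_sum {ι : Type*} {s : Finset ι} {f : ι → ℝ → ℂ} {a b : ℝ}
    (h : ∀ i ∈ s, IntervalIntegrable (f i) volume a b) :
    IntervalIntegrable (fun x => ∑ i ∈ s, f i x) volume a b := by
  simpa only [Finset.sum_fn] using IntervalIntegrable.sum s h

lemma mainTerm_div (l k : ℕ) (u v : ℝ) :
    mainTerm l k v / ((u - v : ℝ) : ℂ) = ∑ m ∈ Finset.range (l + 1), ∑ n ∈ Finset.range (k + 1),
      ((k ! : ℂ) * (E n m / (m ! : ℂ))) * (powLog (l - m) (k - n) v / ((u - v : ℝ) : ℂ)) := by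
  simp only [mainTerm, mainRow, Finset.mul_sum, Finset.sum_div]
  refine Finset.sum_congr rfl fun m _ => Finset.sum_congr rfl fun n _ => ?_
  ring

lemma intervalIntegrable_mainTerm_div (l k : ℕ) {u : ℝ} (hu : 1 ≤ u) :
    IntervalIntegrable (fun v : ℝ => mainTerm l k v / ((u - v : ℝ) : ℂ)) volume 0 (u - 1) := by
  simp only [mainTerm_div]
  exact intervalIntegrable_sum fun m _ => intervalIntegrable_sum fun n _ =>
    (intervalIntegrable_powLog_div _ _ hu).const_mul _

lemma integral_mainTerm_div (l k : ℕ) : ∃ M : ℝ, 0 ≤ M ∧ ∀ u : ℝ, 2 ≤ u →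
    ‖(∫ v in (0 : ℝ)..(u - 1), mainTerm l k v / ((u - v : ℝ) : ℂ)) -
      (l + 1) * mainTerm (l + 1) k u‖ ≤ M * (Real.log (Real.exp 1 * u) ^ l / u) := by
  choose M hM hb using integral_powLog_div
  refine ⟨∑ m ∈ Finset.range (l + 1), ∑ n ∈ Finset.range (k + 1),
    ‖(k ! : ℂ) * (E n m / (m ! : ℂ))‖ * M (l - m), Finset.sum_nonneg fun m _ =>
    Finset.sum_nonneg fun n _ => mul_nonneg (norm_nonneg _) (hM _), fun u hu => ?_⟩
  have hu1 : 1 ≤ u := by linarith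
  have hlog := one_le_log_exp_one_mul hu1
  have hint : ∫ v in (0 : ℝ)..(u - 1), mainTerm l k v / ((u - v : ℝ) : ℂ) =
      ∑ m ∈ Finset.range (l + 1), ∑ n ∈ Finset.range (k + 1),
        ((k ! : ℂ) * (E n m / (m ! : ℂ))) *
          ∫ v in (0 : ℝ)..(u - 1), powLog (l - m) (k - n) v / ((u - v : ℝ) : ℂ) := by
    simp only [mainTerm_div]
    rw [intervalIntegral.integral_finsetSum fun m _ => intervalIntegrable_sum fun n _ =>
      (intervalIntegrable_powLog_div _ _ hu1).const_mul _]
    refine Finset.sum_congr rfl fun m _ => ?_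
    rw [intervalIntegral.integral_finsetSum fun n _ =>
      (intervalIntegrable_powLog_div _ _ hu1).const_mul _]
    simp only [intervalIntegral.integral_const_mul]
  have hmain : (l + 1) * mainTerm (l + 1) k u =
      ∑ m ∈ Finset.range (l + 1), ∑ n ∈ Finset.range (k + 1),
        ((k ! : ℂ) * (E n m / (m ! : ℂ))) * (((l - m : ℕ) + 1) * powLog (l - m + 1) (k - n) u +
          ∑ i ∈ Finset.range (k - n + 1), einCoeff i * powLog (l - m) (k - n - i) u) := by
    rw [← sum_mainRow_succ, Finset.mul_sum]
    refine Finset.sum_congr rfl fun m _ => ?_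
    rw [← mainRow_succ, mainRow, Finset.mul_sum, ← Finset.sum_add_distrib, Finset.sum_div,
      Finset.mul_sum]
    refine Finset.sum_congr rfl fun n _ => ?_
    ring
  rw [hint, hmain, ← Finset.sum_sub_distrib, Finset.sum_mul]
  refine (norm_sum_le _ _).trans (Finset.sum_le_sum fun m hm => ?_)
  rw [← Finset.sum_sub_distrib, Finset.sum_mul]
  refine (norm_sum_le _ _).trans (Finset.sum_le_sum fun n hn => ?_)
  rw [← mul_sub, norm_mul, mul_assoc]
  refine mul_le_mul_of_nonneg_left ?_ (norm_nonneg _)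
  refine (hb (l - m) (k - n) u hu).trans (mul_le_mul_of_nonneg_left ?_ (hM _))
  gcongr
  omega

/-! ### The error term and the induction on `l`. -/

/-- The error in the approximation of `K l u k` by its main term. -/
noncomputable def errTerm (l k : ℕ) (u : ℝ) : ℂ := (K l u k : ℂ) - mainTerm l k u

lemma intervalIntegrable_errTerm_div (l k : ℕ) {u : ℝ} (hu : 1 ≤ u) :
    IntervalIntegrable (fun v : ℝ => errTerm l k v / ((u - v : ℝ) : ℂ)) volume 0 (u - 1) := by
  have h := (K_succ l k hu).1
  have h1 : IntervalIntegrable (fun v : ℝ => ((K l v k / (u - v) : ℝ) : ℂ)) volume 0 (u - 1) :=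
    ⟨h.1.ofReal, h.2.ofReal⟩
  refine (h1.sub (intervalIntegrable_mainTerm_div l k hu)).congr fun v _ => ?_
  simp only [errTerm]
  push_cast
  ring

lemma integral_errTerm_div (l k : ℕ) {u : ℝ} (hu : 1 ≤ u) :
    ∫ v in (0 : ℝ)..(u - 1), errTerm l k v / ((u - v : ℝ) : ℂ) =
      (l + 1) * (K (l + 1) u k : ℂ) -
        ∫ v in (0 : ℝ)..(u - 1), mainTerm l k v / ((u - v : ℝ) : ℂ) := by
  obtain ⟨h, hv⟩ := K_succ l k hu
  have h1 : IntervalIntegrable (fun v : ℝ => ((K l v k / (u - v) : ℝ) : ℂ)) volume 0 (u - 1) :=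
    ⟨h.1.ofReal, h.2.ofReal⟩
  have h2 : (l + 1) * (K (l + 1) u k : ℂ) =
      ∫ v in (0 : ℝ)..(u - 1), ((K l v k / (u - v) : ℝ) : ℂ) := by
    rw [intervalIntegral.integral_ofReal, ← hv]
    push_cast
    rfl
  rw [h2, ← intervalIntegral.integral_sub h1 (intervalIntegrable_mainTerm_div l k hu)]
  congr 1
  ext v
  simp only [errTerm]
  push_cast
  ring

/-- The recursion at `u = 2` yields integrability on `[0,1]` once the bounded factor `2 - v` is
removed. Near `0` nothing stronger than integrability is needed. -/
lemma intervalIntegrable_of_div_two_sub {f : ℝ → ℂ}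
    (h : IntervalIntegrable (fun v : ℝ => f v / ((2 - v : ℝ) : ℂ)) volume 0 1) :
    IntervalIntegrable f volume 0 1 := by
  have h1 := h.mul_continuousOn (g := fun v : ℝ => ((2 - v : ℝ) : ℂ)) (by fun_prop)
  refine h1.congr fun v hv => ?_
  rw [Set.uIoc_of_le zero_le_one] at hv
  have : ((2 - v : ℝ) : ℂ) ≠ 0 := by exact_mod_cast (by linarith [hv.2] : (0 : ℝ) < 2 - v).ne'
  exact div_mul_cancel₀ _ this

lemma intervalIntegrable_errTerm (l k : ℕ) : IntervalIntegrable (errTerm l k) volume 0 1 := by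
  have h := intervalIntegrable_errTerm_div l k one_le_two
  rw [show (2 : ℝ) - 1 = 1 by norm_num] at h
  exact intervalIntegrable_of_div_two_sub h

lemma intervalIntegrable_mainTerm (l k : ℕ) : IntervalIntegrable (mainTerm l k) volume 0 1 := by
  have h := intervalIntegrable_mainTerm_div l k one_le_two
  rw [show (2 : ℝ) - 1 = 1 by norm_num] at h
  exact intervalIntegrable_of_div_two_sub h

lemma intervalIntegrable_K (l k : ℕ) :
    IntervalIntegrable (fun v => (K l v k : ℂ)) volume 0 1 := by
  refine ((intervalIntegrable_errTerm l k).add (intervalIntegrable_mainTerm l k)).congr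
    fun v _ => ?_
  simp [errTerm]

/-- On this range `u - v ≥ u/2`, so integrability of the error already gives a contribution of order
`1/u`. -/
lemma norm_integral_errTerm_left_le (l k : ℕ) {u : ℝ} (hu : 2 ≤ u) :
    ‖∫ v in (0 : ℝ)..1, errTerm l k v / ((u - v : ℝ) : ℂ)‖ ≤
      2 * (∫ v in (0 : ℝ)..1, ‖errTerm l k v‖) / u := by
  have hu0 : 0 < u := by linarith
  have h := intervalIntegral.norm_integral_le_of_norm_le (a := 0) (b := 1) (μ := volume)
    (f := fun v : ℝ => errTerm l k v / ((u - v : ℝ) : ℂ))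
    (g := fun v => ‖errTerm l k v‖ * (2 / u)) zero_le_one
    (ae_of_all _ fun v hv => by
      have hv' : u / 2 ≤ u - v := by linarith [hv.2]
      rw [norm_div, Complex.norm_real, Real.norm_of_nonneg (by linarith), div_eq_mul_inv]
      refine mul_le_mul_of_nonneg_left ?_ (norm_nonneg _)
      rw [← inv_div]
      exact inv_anti₀ (by positivity) hv')
    ((intervalIntegrable_errTerm l k).norm.mul_const _)
  rw [intervalIntegral.integral_mul_const] at h
  refine h.trans (le_of_eq ?_)
  ring

/-- By `1/(v(u-v)) = (1/v + 1/(u-v))/u`, and each summand integrates to `log (u-1)`: this is the one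
extra logarithm. -/
lemma norm_integral_errTerm_right_le (l k : ℕ) {A u : ℝ} (hA : 0 ≤ A) (hu : 2 ≤ u)
    (h : ∀ v : ℝ, 1 ≤ v → ‖errTerm l k v‖ ≤ A * (Real.log (Real.exp 1 * v) ^ l / v)) :
    ‖∫ v in (1 : ℝ)..(u - 1), errTerm l k v / ((u - v : ℝ) : ℂ)‖ ≤
      2 * A * (Real.log (Real.exp 1 * u) ^ (l + 1) / u) := by
  have hu0 : 0 < u := by linarith
  have hlogu := one_le_log_exp_one_mul (by linarith : 1 ≤ u)
  set B : ℝ := A * Real.log (Real.exp 1 * u) ^ l / u with hB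
  have hB0 : 0 ≤ B := by positivity
  have hi1 : IntervalIntegrable (fun v : ℝ => 1 / v) volume 1 (u - 1) := by
    refine ContinuousOn.intervalIntegrable (ContinuousOn.div (by fun_prop) (by fun_prop)
      fun v hv => ?_)
    rw [Set.uIcc_of_le (by linarith)] at hv
    linarith [hv.1]
  have hi2 : IntervalIntegrable (fun v : ℝ => 1 / (u - v)) volume 1 (u - 1) := by
    refine ContinuousOn.intervalIntegrable (ContinuousOn.div (by fun_prop) (by fun_prop)
      fun v hv => ?_)
    rw [Set.uIcc_of_le (by linarith)] at hv
    linarith [hv.2]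
  have hle := intervalIntegral.norm_integral_le_of_norm_le (a := 1) (b := u - 1) (μ := volume)
    (f := fun v : ℝ => errTerm l k v / ((u - v : ℝ) : ℂ))
    (g := fun v => B * (1 / v + 1 / (u - v))) (by linarith)
    (ae_of_all _ fun v hv => by
      have hv0 : 0 < v := by linarith [hv.1]
      have huv : 0 < u - v := by linarith [hv.2]
      rw [norm_div, Complex.norm_real, Real.norm_of_nonneg huv.le, div_le_iff₀ huv]
      refine (h v hv.1.le).trans ?_
      have h1 := one_le_log_exp_one_mul hv.1.le
      have h2 : Real.log (Real.exp 1 * v) ≤ Real.log (Real.exp 1 * u) :=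
        Real.log_le_log (by positivity) (by
          have : v ≤ u := by linarith
          gcongr)
      calc A * (Real.log (Real.exp 1 * v) ^ l / v)
          ≤ A * (Real.log (Real.exp 1 * u) ^ l / v) := by gcongr
        _ = B * (1 / v + 1 / (u - v)) * (u - v) := by
            rw [hB]; field_simp; ring)
    ((hi1.add hi2).const_mul B)
  refine hle.trans ?_
  rw [intervalIntegral.integral_const_mul, intervalIntegral.integral_add hi1 hi2,
    intervalIntegral.integral_comp_sub_left (fun y => 1 / y) u, sub_sub_cancel,
    integral_one_div_of_pos one_pos (by linarith), div_one]
  have hlog : Real.log (u - 1) ≤ Real.log (Real.exp 1 * u) := by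
    rw [log_exp_one_mul hu0]
    have := Real.log_le_log (by linarith : 0 < u - 1) (by linarith : u - 1 ≤ u)
    linarith
  calc B * (Real.log (u - 1) + Real.log (u - 1))
      ≤ B * (Real.log (Real.exp 1 * u) + Real.log (Real.exp 1 * u)) := by gcongr
    _ = 2 * A * (Real.log (Real.exp 1 * u) ^ (l + 1) / u) := by rw [hB]; ring

/-- For `u ≤ 2` the recursion only sees `v` in `[0,1]`, with `u - v ≥ 1`, so `K (l+1)` is bounded by
the integral of `|K l|` there; the main term is continuous on a compact interval. -/
lemma exists_errTerm_bound_near_one (l k : ℕ) :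
    ∃ B : ℝ, 0 ≤ B ∧ ∀ u ∈ Set.Icc (1 : ℝ) 2, ‖errTerm (l + 1) k u‖ ≤ B := by
  obtain ⟨B, hB⟩ := isCompact_Icc.exists_bound_of_continuousOn ((continuousOn_mainTerm (l + 1) k).mono
    (fun u (hu : u ∈ Set.Icc (1 : ℝ) 2) => show (0 : ℝ) < u by linarith [hu.1]))
  have hB0 : 0 ≤ B := (norm_nonneg _).trans (hB 1 ⟨le_rfl, one_le_two⟩)
  set J : ℝ := ∫ v in (0 : ℝ)..1, ‖(K l v k : ℂ)‖ with hJ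
  have hJ0 : 0 ≤ J := intervalIntegral.integral_nonneg zero_le_one fun v _ => norm_nonneg _
  refine ⟨J + B, by positivity, fun u hu => ?_⟩
  rw [errTerm]
  refine (norm_sub_le _ _).trans (add_le_add ?_ (hB u hu))
  have hint := (intervalIntegrable_K l k).norm
  have h1 : ‖(l + 1 : ℝ) * K (l + 1) u k‖ ≤ J := by
    rw [(K_succ l k hu.1).2]
    refine (intervalIntegral.norm_integral_le_of_norm_le (g := fun v => ‖(K l v k : ℂ)‖)
      (by linarith [hu.1]) (ae_of_all _ fun v hv => ?_) (hint.mono_set ?_)).trans ?_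
    · rw [norm_div, Complex.norm_real, Real.norm_of_nonneg (by linarith [hv.2] : 0 ≤ u - v)]
      exact div_le_self (norm_nonneg _) (by linarith [hv.2])
    · rw [Set.uIcc_of_le (by linarith [hu.1]), Set.uIcc_of_le zero_le_one]
      exact Set.Icc_subset_Icc le_rfl (by linarith [hu.2])
    · exact intervalIntegral.integral_mono_interval le_rfl (by linarith [hu.1]) (by linarith [hu.2])
        (ae_of_all _ fun v => norm_nonneg _) hint
  rw [norm_mul, Real.norm_of_nonneg (by positivity)] at h1
  rw [Complex.norm_real]
  refine le_trans ?_ h1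
  exact le_mul_of_one_le_left (norm_nonneg _) (by linarith [Nat.cast_nonneg (α := ℝ) l])

/-- The range `u ≥ 1` instead of `u ≥ l` is what lets the induction run: the recursion integrates
the error over all of `[1, u-1]`. For `l = 0` the error is exactly `0`. -/
theorem norm_errTerm_le (l k : ℕ) : ∃ A : ℝ, 0 ≤ A ∧ ∀ u : ℝ, 1 ≤ u →
    ‖errTerm l k u‖ ≤ A * (Real.log (Real.exp 1 * u) ^ l / u) := by
  induction l with
  | zero =>
    refine ⟨0, le_rfl, fun u hu => ?_⟩
    rw [errTerm, K_zero (by linarith), mainTerm_zero]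
    simp
  | succ l ih =>
    obtain ⟨A, hA, hl⟩ := ih
    obtain ⟨M, hM, hmain⟩ := integral_mainTerm_div l k
    obtain ⟨B, hB, hnear⟩ := exists_errTerm_bound_near_one l k
    set J : ℝ := ∫ v in (0 : ℝ)..1, ‖errTerm l k v‖ with hJ
    have hJ0 : 0 ≤ J := intervalIntegral.integral_nonneg zero_le_one fun v _ => norm_nonneg _
    -- `M` bounds the defect of the main term in the recursion, `2J` and `2A` the old error on
    -- `[0,1]` and `[1, u-1]`. The term `2B` covers `u ≤ 2`, where `W ≥ 1/u ≥ 1/2`.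
    refine ⟨M + 2 * J + 2 * A + 2 * B, by positivity, fun u hu => ?_⟩
    have hu0 : 0 < u := by linarith
    have hlog := one_le_log_exp_one_mul hu
    set W : ℝ := Real.log (Real.exp 1 * u) ^ (l + 1) / u with hW
    have hW1 : 1 / u ≤ W := by
      rw [hW]; gcongr; exact one_le_pow₀ hlog
    have hW0 : 0 ≤ W := le_trans (by positivity) hW1
    rcases le_total u 2 with h2 | h2
    · have hhalf : 1 / 2 ≤ W := le_trans (one_div_le_one_div_of_le hu0 h2) hW1
      refine (hnear u ⟨hu, h2⟩).trans ?_
      have h3 : 0 ≤ (M + 2 * J + 2 * A) * W := by positivity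
      nlinarith
    · have hWl : Real.log (Real.exp 1 * u) ^ l / u ≤ W := by
        rw [hW]; gcongr
        exact Nat.le_succ l
      have hint := intervalIntegrable_errTerm_div l k hu
      have e := integral_errTerm_div l k hu
      rw [← intervalIntegral.integral_add_adjacent_intervals (b := 1)
        (hint.mono_set (by
          rw [Set.uIcc_of_le zero_le_one, Set.uIcc_of_le (by linarith)]
          exact Set.Icc_subset_Icc le_rfl (by linarith)))
        (hint.mono_set (by
          rw [Set.uIcc_of_le (by linarith), Set.uIcc_of_le (by linarith)]
          exact Set.Icc_subset_Icc zero_le_one le_rfl))] at e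
      have hL := norm_integral_errTerm_left_le l k h2
      have hR := norm_integral_errTerm_right_le l k hA h2 hl
      have hTm := hmain u h2
      have hdec : ((l : ℂ) + 1) * errTerm (l + 1) k u =
          (∫ v in (0 : ℝ)..1, errTerm l k v / ((u - v : ℝ) : ℂ)) +
          (∫ v in (1 : ℝ)..(u - 1), errTerm l k v / ((u - v : ℝ) : ℂ)) +
          ((∫ v in (0 : ℝ)..(u - 1), mainTerm l k v / ((u - v : ℝ) : ℂ)) -
            (l + 1) * mainTerm (l + 1) k u) := by
        rw [e, errTerm]; ring
      have hl1 : ‖(l : ℂ) + 1‖ = (l : ℝ) + 1 := by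
        exact_mod_cast Complex.norm_natCast (l + 1)
      have hle : ‖errTerm (l + 1) k u‖ ≤ ‖((l : ℂ) + 1) * errTerm (l + 1) k u‖ := by
        rw [norm_mul, hl1]
        exact le_mul_of_one_le_left (norm_nonneg _) (by linarith [Nat.cast_nonneg (α := ℝ) l])
      have hJW : 2 * J / u ≤ 2 * J * W := by
        rw [div_eq_mul_one_div]; gcongr
      have hMW : M * (Real.log (Real.exp 1 * u) ^ l / u) ≤ M * W := by gcongr
      have hBW : 0 ≤ 2 * B * W := by positivity
      calc ‖errTerm (l + 1) k u‖ ≤ _ := hle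
        _ ≤ _ := by rw [hdec]; exact norm_add₃_le
        _ ≤ 2 * J * W + 2 * A * W + M * W :=
            add_le_add (add_le_add (hL.trans hJW) hR) (hTm.trans hMW)
        _ ≤ (M + 2 * J + 2 * A + 2 * B) * W := by linarith

end DickmanRelatives

theorem theorem2 :
    -- the generating functions of the constants, valid in the whole complex plane
    (∀ (k : ℕ) (z : ℂ), HasSum (fun r : ℕ => DickmanRelatives.C r k * z ^ r)
      (Complex.exp ((Real.eulerMascheroniConstant : ℂ) * z) / Complex.Gamma ((k : ℂ) + 1 - z))) ∧
    (∀ (m : ℕ) (z : ℂ), HasSum (fun n : ℕ => DickmanRelatives.E n m * z ^ n)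
      (DickmanRelatives.Ein z ^ m)) ∧
    -- the expansion, with an error constant depending on `k` and `l` only
    (∀ (k l : ℕ), 1 ≤ l → ∃ A : ℝ, ∀ u : ℝ, (l : ℝ) ≤ u →
      ‖(DickmanRelatives.K l u k : ℂ) -
          ∑ m ∈ Finset.range (min k l + 1), ∑ n ∈ Finset.Icc m k,
            ∑ r ∈ Finset.range (l - m + 1),
              DickmanRelatives.D m n r k l * (u : ℂ) ^ (k - n) *
                ((Real.log u : ℝ) : ℂ) ^ (l - m - r)‖
        ≤ A * (Real.log (Real.exp 1 * u) ^ l / u)) := by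
  refine ⟨DickmanRelatives.hasSum_C, DickmanRelatives.hasSum_E, fun k l hl => ?_⟩
  obtain ⟨A, _, hA⟩ := DickmanRelatives.norm_errTerm_le l k
  refine ⟨A, fun u hu => ?_⟩
  rw [DickmanRelatives.mainTerm_eq_sum]
  exact hA u (le_trans (by exact_mod_cast hl) hu)
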